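/- **Setting ($\gamma=3$).** Let $M(\varrho)=\sqrt{1-\varrho^2}/\varrho$ be the Mach number, $\varrho_{\mathrm{cr}}=1/\sqrt2$, $\nu(\varrho)=\int_0^\varrho\frac{\tau^2}{1-\tau^2}\,d\tau$, $\nu_{\mathrm{cr}}=\nu(\varrho_{\mathrm{cr}})$, and let $\varrho(\nu)$ be the inverse of $\nu(\cdot)$ from $[0,\nu_{\mathrm{cr}}]$ onto $[0,\varrho_{\mathrm{cr}}]$. Define $k(\nu)=\int_0^{\varrho(\nu)}\frac{\sqrt{M(\tau)^2-1}}{\tau\,M(\tau)^2}\,d\tau$, so that $k'(\nu)^2=(M(\varrho(\nu))^2-1)/\varrho(\nu)^2$ on $(0,\nu_{\mathrm{cr}})$. Fix $\nu_*\in(0,\nu_{\mathrm{cr}})$. A *regular kernel* on $[0,\nu_*]$ is a distributional solution $H^{\mathrm r}$ of $$H^{\mathrm r}_{\nu\nu}-k'(\nu)^2H^{\mathrm r}_{ss}=0\ \text{ in }(0,\nu_*]\times\mathbb R,\qquad H^{\mathrm r}|_{\nu=0}=0,\qquad H^{\mathrm r}_\nu|_{\nu=0}=\delta_0,$$ supported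 in $\{(\nu,s):|s|\le k(\nu)\}$; here $\nu\mapsto H^{\mathrm r}(\nu,\cdot)$ is a $C^1$ function of $\nu\in[0,\nu_*]$ with values in the distributions in $s$ (derivatives in $\nu$ being taken after pairing with each test function of $s$), and the equation holds in the distributions in $s$ for every $\nu\in(0,\nu_*]$. **Proposition.** A regular kernel on $[0,\nu_*]$ exists, and every regular kernel $H^{\mathrm r}$ has the following property. For every $\varphi\in C^\infty(\mathbb R)$ and every $\nu\in[0,\nu_*]$ the convolutions in $s$ below are smooth functions of $s$, and for every $R>0$ there is a constant $C=C_{\varphi,R}>0$, independent of $(\nu,s)$, such that for all $\nu\in[0,\nu_*]$, $s\in[-R,R]$ and $j=0,1,2$, $$\big|\partial_s^j\big[(\varrho(\nu)H^{\mathrm r}_\nu(\nu,\cdot)+H^{\mathrm r}_{ss}(\nu,\cdot))*\varphi\big](s)\big|\le C\,\varrho(\nu),$$ $$\big|\varrho(\nu)\,\partial_s^j\big[H^{\mathrm r}_\nu(\nu,\cdot)*\varphi\big](s)\big|+\big|\partial_s^j\big[H^{\mathrm r}_s(\nu,\cdot)*\varphi\big](s)\big|\le C.$$ If, moreover, $\varphi$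 and each of its derivatives are bounded on $\mathbb R$ (in particular if $\varphi\in C_c^\infty(\mathbb R)$), then there is a constant $C=C_\varphi>0$ such that both estimates hold for all $(\nu,s)\in[0,\nu_*]\times\mathbb R$ and $j=0,1,2$. -/

import Mathlib

open Set
open scoped Distributions LineDeriv ContDiff

namespace Morawetz

noncomputable section

/-- The Mach number `M = q / c` as a function of the density, for `γ = 3`: the Bernoulli law is
`ϱ = √(1 - q²)` and the local sound speed is `c = ϱ`. -/
def mach (ϱ : ℝ) : ℝ := √(1 - ϱ ^ 2) / ϱ

/-- The critical (sonic) density, at which `M = 1`. -/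
def rhoCr : ℝ := 1 / √2

/-- The renormalized density `ν(ϱ)`. -/
def nuOf (ϱ : ℝ) : ℝ := ∫ τ in (0 : ℝ)..ϱ, τ ^ 2 / (1 - τ ^ 2)

/-- The critical renormalized density `ν_cr = ν(ϱ_cr)`. -/
def nuCr : ℝ := nuOf rhoCr

/-- The density `ϱ(ν)`: the inverse of `ϱ ↦ ν(ϱ)` from `[0, ν_cr]` onto `[0, ϱ_cr]`. -/
def rho (ν : ℝ) : ℝ := Function.invFunOn nuOf (Icc 0 rhoCr) ν

/-- The characteristic speed `k`, as a function of the renormalized density. -/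
def charSpeed (ν : ℝ) : ℝ :=
  ∫ ϱ in (0 : ℝ)..rho ν, √(mach ϱ ^ 2 - 1) / ϱ * (1 / mach ϱ ^ 2)

/-- The coefficient `(M² - 1) / ϱ²` of the entropy generator equation; it equals `k'(ν)²`. -/
def waveCoeff (ν : ℝ) : ℝ := (mach (rho ν) ^ 2 - 1) / rho ν ^ 2

/-- `(H, Hν)` is a regular kernel of the entropy generator equation on `[0, νs]` together with its
`ν`-derivative: `H` is a distributional solution, supported in the light cone `|s| ≤ k(ν)`, of
`H_νν - k'(ν)² H_ss = 0`, `H|_{ν = 0} = 0`, `H_ν|_{ν = 0} = δ₀`.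
Both `H` and `Hν` are functions of `ν` with values in the distributions in the variable `s`;
derivatives in `ν` are taken after pairing with an arbitrary test function of `s` (one-sided at
the end points of `[0, νs]`), and derivatives in `s` are distributional. -/
structure IsRegularKernel (νs : ℝ) (H Hν : ℝ → 𝓓'((⊤ : TopologicalSpace.Opens ℝ), ℝ)) : Prop where
  hasDeriv : ∀ ψ : 𝓓((⊤ : TopologicalSpace.Opens ℝ), ℝ), ∀ ν ∈ Icc 0 νs,
    HasDerivWithinAt (fun t => H t ψ) (Hν ν ψ) (Icc 0 νs) ν
  continuous_deriv : ∀ ψ : 𝓓((⊤ : TopologicalSpace.Opens ℝ), ℝ),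
    ContinuousOn (fun t => Hν t ψ) (Icc 0 νs)
  wave : ∀ ψ : 𝓓((⊤ : TopologicalSpace.Opens ℝ), ℝ), ∀ ν ∈ Ioc 0 νs,
    HasDerivWithinAt (fun t => Hν t ψ)
      (waveCoeff ν * (∂_{(1 : ℝ)} (∂_{(1 : ℝ)} (H ν))) ψ) (Icc 0 νs) ν
  init : H 0 = 0
  init_deriv : Hν 0 = Distribution.delta 0
  support_subset : ∀ ν ∈ Icc 0 νs, Distribution.IsVanishingOn (H ν) {s : ℝ | charSpeed ν < |s|}

/-- A smooth cutoff that equals `1` on `[-|r| - 1, |r| + 1]` and is supported in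
`[-|r| - 2, |r| + 2]`. -/
def cutoff (r : ℝ) : ContDiffBump (0 : ℝ) where
  rIn := |r| + 1
  rOut := |r| + 2
  rIn_pos := by positivity
  rIn_lt_rOut := by linarith

/-- The test function `t ↦ χ(t) φ(s - t)`, with `χ` the cutoff above. -/
def shiftedTest (r : ℝ) (φ : ℝ → ℝ) (hφ : ContDiff ℝ ∞ φ) (s : ℝ) :
    𝓓((⊤ : TopologicalSpace.Opens ℝ), ℝ) where
  toFun t := cutoff r t * φ (s - t)
  contDiff' := (cutoff r).contDiff.mul (hφ.comp (contDiff_const.sub contDiff_id))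
  hasCompactSupport' := (cutoff r).hasCompactSupport.mul_right
  tsupport_subset' := fun _ _ => trivial

/-- The value at `s` of the convolution `T * φ` of a distribution `T` supported in `[-r, r]` with a
smooth function `φ`, that is `⟨T, φ(s - ·)⟩`. -/
def smoothConv (r : ℝ) (T : 𝓓'((⊤ : TopologicalSpace.Opens ℝ), ℝ)) (φ : ℝ → ℝ)
    (hφ : ContDiff ℝ ∞ φ) (s : ℝ) : ℝ :=
  T (shiftedTest r φ hφ s)

/-- The convolution does not depend on the cutoff: any test function that agrees with `φ(s - ·)`
near `[-r, r]` gives the same value. -/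
theorem smoothConv_eq {r : ℝ} {T : 𝓓'((⊤ : TopologicalSpace.Opens ℝ), ℝ)}
    (hT : Distribution.IsVanishingOn T {t : ℝ | r < |t|}) {φ : ℝ → ℝ} (hφ : ContDiff ℝ ∞ φ)
    (s : ℝ) (ψ : 𝓓((⊤ : TopologicalSpace.Opens ℝ), ℝ)) {ε : ℝ} (hε : 0 < ε)
    (hψ : ∀ t : ℝ, |t| < r + ε → ψ t = φ (s - t)) : smoothConv r T φ hφ s = T ψ := by
  have key : T (shiftedTest r φ hφ s - ψ) = 0 := by
    refine hT _ fun t ht => ?_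
    by_contra hlt
    have hlt' : |t| ≤ r := not_lt.mp hlt
    refine (notMem_tsupport_iff_eventuallyEq.mpr ?_) ht
    have hopen : IsOpen {x : ℝ | |x| < r + min ε 1} := isOpen_lt continuous_abs continuous_const
    filter_upwards [hopen.mem_nhds
      (show |t| < r + min ε 1 by linarith [lt_min hε one_pos])] with x hx
    have hx : |x| < r + min ε 1 := hx
    have h1 : cutoff r x = 1 := by
      refine (cutoff r).one_of_mem_closedBall ?_
      rw [mem_closedBall_zero_iff, Real.norm_eq_abs]
      change |x| ≤ |r| + 1
      linarith [min_le_right ε 1, le_abs_self r]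
    have h2 := hψ x (by linarith [min_le_left ε 1])
    change cutoff r x * φ (s - x) - ψ x = 0
    rw [h1, h2]; ring
  rw [map_sub, sub_eq_zero] at key
  exact key

/-- The distribution `ϱ H_ν + H_ss` in the variable `s`, at the given `ν`. -/
def cancelDist (H Hν : ℝ → 𝓓'((⊤ : TopologicalSpace.Opens ℝ), ℝ)) (ν : ℝ) :
    𝓓'((⊤ : TopologicalSpace.Opens ℝ), ℝ) :=
  rho ν • Hν ν + ∂_{(1 : ℝ)} (∂_{(1 : ℝ)} (H ν))

/-- The estimates at the point `(ν, s)` with constant `C`, for `s`-derivatives of order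
`j = 0, 1, 2`. -/
def EstimatesAt (νs : ℝ) (H Hν : ℝ → 𝓓'((⊤ : TopologicalSpace.Opens ℝ), ℝ)) (φ : ℝ → ℝ)
    (hφ : ContDiff ℝ ∞ φ) (C ν s : ℝ) : Prop :=
  ∀ j ≤ 2,
    |iteratedDeriv j (smoothConv (charSpeed νs) (cancelDist H Hν ν) φ hφ) s| ≤ C * rho ν ∧
    |rho ν * iteratedDeriv j (smoothConv (charSpeed νs) (Hν ν) φ hφ) s| +
      |iteratedDeriv j (smoothConv (charSpeed νs) (∂_{(1 : ℝ)} (H ν)) φ hφ) s| ≤ C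

end

end Morawetz

/-! Estimates. For each test function `ψ`, `ν ↦ Hν ν ψ` is continuous on the compact interval `[0,
νs]`, hence bounded. The smooth functions supported in a fixed compact set form a Fréchet space, so
Banach-Steinhaus makes the family `Hν ν` uniformly of finite order there. Convolutions of `H_ν`,
`∂_s H_ν`, `∂_s² H_ν` with `φ` and its derivatives are therefore bounded uniformly in `ν`. Since `H`
vanishes at `ν = 0`, the mean value inequality bounds the convolutions of `H_s` and `H_ss` by a
multiple of `ν`, and `ν ≤ ϱ(ν)` because the integrand defining `ν(ϱ)` is at most `1`. So `ϱ H_ν` and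
`H_ss` are each `O(ϱ)`; no cancellation between them is needed (`IsRegularKernel.exists_estimates`).

Existence. The coefficient `w = k'²` blows up at `ν = 0`, but it is positive and decreasing and `k`
is continuous with `k(0) = 0`. The equation is split into the weak system `u(f)' = (w / 2) G(f')`,
`G(f)' = 2 u(f')` with `u = H_ν`, `G(f) = 2 H(f')`. It is discretized by a persistent random walk
with speed `√w`: monotonicity of `w` makes the turning probabilities nonnegative, so the forms are
bounded by the supremum norm, and the steps are dominated by increments of `k`, so the walk stays in
the cone `|s| ≤ k(ν)`. Taylor estimates uniform in the mesh survive the limit along an ultrafilter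
and give the system (`limMean_sub_taylor`, `limFlux_sub_taylor`). The kernel is the primitive of
`u`, and `limFlux_eq` turns the system into the wave equation. -/

namespace ContDiffMapSupportedIn

/-! ### Smooth functions supported in a compact set: completeness and uniform boundedness. -/

open Filter Topology TopologicalSpace

variable {E F : Type*} [NormedAddCommGroup E] [NormedSpace ℝ E] [NormedAddCommGroup F]
  [NormedSpace ℝ F] {K : Compacts E}

/-- A uniform limit, together with all derivatives, of smooth functions supported in `K` is a smooth
function supported in `K`. -/
theorem isClosed_range_pi_structureMapCLM :
    IsClosed (range (ContinuousLinearMap.pi (structureMapCLM ℝ ⊤) :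
      𝓓_{K}(E, F) →L[ℝ] Π i, BoundedContinuousFunction E (E [×i]→L[ℝ] F))) := by
  refine IsSeqClosed.isClosed fun u p hu hp => ?_
  choose f hf using hu
  have hunif : ∀ i, TendstoUniformly (fun k => iteratedFDeriv ℝ i (f k)) (p i) atTop := by
    intro i
    have h1 := BoundedContinuousFunction.tendsto_iff_tendstoUniformly.mp ((tendsto_pi_nhds.mp hp) i)
    have h2 : (fun k => (u k i : E → E [×i]→L[ℝ] F)) = fun k => iteratedFDeriv ℝ i (f k) := by
      funext k
      rw [← hf k]
      exact structureMapCLM_top_apply ℝ (f k)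
    rwa [h2] at h1
  have hpt : ∀ i x, Tendsto (fun k => iteratedFDeriv ℝ i (f k) x) atTop (𝓝 (p i x)) :=
    fun i x => (hunif i).tendsto_at x
  -- The order-zero component of the limit is the candidate function; the other components will be
  -- its Taylor series, since derivatives pass to uniform limits.
  set g : E → F := fun x => p 0 x 0 with hg
  have hgx : ∀ x, Tendsto (fun k => f k x) atTop (𝓝 (g x)) := by
    intro x
    have := ((ContinuousMultilinearMap.apply ℝ (fun _ : Fin 0 => E) F 0).continuous.tendsto
      (p 0 x)).comp (hpt 0 x)
    simpa [Function.comp_def, hg, Subsingleton.elim (0 : Fin 0 → E) ![]] using this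
  have htay : HasFTaylorSeriesUpTo ∞ g (fun x i => p i x) := by
    constructor
    · intro x; rfl
    · intro m _ x
      refine hasFDerivAt_of_tendstoUniformly (l := atTop)
        (f := fun k x => iteratedFDeriv ℝ m (f k) x)
        (f' := fun k x => (iteratedFDeriv ℝ (m + 1) (f k) x).curryLeft)
        (g' := fun x => (p (m + 1) x).curryLeft) ?_ ?_ (hpt m) x
      · exact (continuousMultilinearCurryLeftEquiv ℝ (fun _ : Fin (m + 1) => E)
          F).isometry.uniformContinuous.comp_tendstoUniformly (hunif (m + 1))
      · intro k y
        have hk : ContDiff ℝ ∞ (f k) := (f k).contDiff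
        exact (contDiff_iff_ftaylorSeries.mp hk).fderiv m (by exact_mod_cast WithTop.coe_lt_top m) y
    · intro m _
      exact (p m).continuous
  have hgc : ContDiff ℝ ∞ g := htay.contDiff
  have hg0 : EqOn g 0 Kᶜ := by
    intro x hx
    refine tendsto_nhds_unique (hgx x) ?_
    have : (fun k => f k x) = fun _ => 0 := funext fun k => (f k).zero_on_compl hx
    rw [this]; exact tendsto_const_nhds
  refine ⟨⟨g, hgc, hg0⟩, ?_⟩
  funext i
  refine DFunLike.coe_injective ?_
  refine (structureMapCLM_top_apply ℝ _).trans ?_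
  funext x
  exact (htay.eq_iteratedFDeriv (by exact_mod_cast le_top) x).symm

/-- Completeness and, below, a countable basis of the uniformity make the space Baire, hence
barrelled, as the uniform boundedness principle requires. -/
instance completeSpace [CompleteSpace F] : CompleteSpace 𝓓_{K}(E, F) :=
  (isUniformEmbedding_pi_structureMapCLM ℝ).isUniformInducing.completeSpace
    isClosed_range_pi_structureMapCLM.isComplete

instance isCountablyGenerated_uniformity :
    (uniformity 𝓓_{K}(E, F)).IsCountablyGenerated := by
  rw [← (isUniformEmbedding_pi_structureMapCLM (K := K) (F := F) (n := ⊤) ℝ).comap_uniformity]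
  infer_instance

/-- **Banach-Steinhaus** for distributions: a pointwise bounded family of continuous linear forms
on the smooth functions supported in `K` is uniformly of finite order. -/
theorem exists_bound_of_pointwise_bounded {ι : Type*} [CompleteSpace F]
    (T : ι → 𝓓_{K}(E, F) →L[ℝ] ℝ) (hT : ∀ f : 𝓓_{K}(E, F), ∃ C : ℝ, ∀ i, |T i f| ≤ C) :
    ∃ (N : ℕ) (C : ℝ), 0 ≤ C ∧ ∀ i (f : 𝓓_{K}(E, F)) (B : ℝ), 0 ≤ B →
      (∀ j ≤ N, ∀ x ∈ K, ‖iteratedFDeriv ℝ j f x‖ ≤ B) → |T i f| ≤ C * B := by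
  have hue : UniformEquicontinuous ((↑) ∘ T : ι → 𝓓_{K}(E, F) → ℝ) := by
    refine (norm_withSeminorms ℝ ℝ).banach_steinhaus fun _ f => ?_
    obtain ⟨C, hC⟩ := hT f
    exact ⟨C, by rintro _ ⟨i, rfl⟩; exact hC i⟩
  have htfae := (norm_withSeminorms ℝ ℝ).equicontinuous_TFAE
    (fun i => (T i).toLinearMap)
  have h3 := (htfae.out 2 3 rfl rfl).mp hue
  obtain ⟨p, hp, hpT⟩ := h3 0
  obtain ⟨s, C, -, hC⟩ := Seminorm.bound_of_continuous
    (ContDiffMapSupportedIn.withSeminorms ℝ E F ⊤ K) p hp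
  -- The order is the largest index among the finitely many seminorms that dominate `p`.
  refine ⟨s.sup id, C, C.2, fun i f B hB h => ?_⟩
  have h1 : |T i f| ≤ p f := hpT i f
  refine h1.trans ((hC f).trans ?_)
  refine mul_le_mul_of_nonneg_left ?_ C.2
  refine Seminorm.finset_sup_apply_le hB fun j hj => ?_
  exact (ContDiffMapSupportedIn.seminorm_top_le_iff ℝ hB j f).mpr
    (h j (Finset.le_sup (f := id) hj))

end ContDiffMapSupportedIn

namespace Morawetz

open Filter Topology TopologicalSpace MeasureTheory

/-! ### Calculus preliminaries -/

theorem hasDerivWithinAt_of_modulus {S : Set ℝ} {f m : ℝ → ℝ} {f' x : ℝ}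
    (hm : Tendsto m (𝓝[S] x) (𝓝 0))
    (h : ∀ᶠ y in 𝓝[S] x, |f y - f x - (y - x) * f'| ≤ m y * |y - x|) :
    HasDerivWithinAt f f' S x := by
  rw [hasDerivWithinAt_iff_isLittleO, Asymptotics.isLittleO_iff]
  intro c hc
  filter_upwards [h, hm.eventually (Iio_mem_nhds hc)] with y hy hyc
  rw [smul_eq_mul, Real.norm_eq_abs, Real.norm_eq_abs]
  exact hy.trans (mul_le_mul_of_nonneg_right (le_of_lt hyc) (abs_nonneg _))

theorem abs_sub_le_of_hasDerivAt {s : Set ℝ} (hs : Convex ℝ s) {f f' : ℝ → ℝ} {M : ℝ}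
    (hf : ∀ x, HasDerivAt f (f' x) x) (hM : ∀ x ∈ s, |f' x| ≤ M) {x y : ℝ}
    (hx : x ∈ s) (hy : y ∈ s) : |f y - f x| ≤ M * |y - x| :=
  hs.norm_image_sub_le_of_norm_hasDerivWithin_le (fun z _ => (hf z).hasDerivWithinAt) hM hx hy

theorem abs_taylor_le_of_hasDerivAt {s : Set ℝ} (hs : Convex ℝ s) {f f' f'' : ℝ → ℝ} {M : ℝ}
    (hf : ∀ x, HasDerivAt f (f' x) x) (hf' : ∀ x, HasDerivAt f' (f'' x) x)
    (hM : ∀ x ∈ s, |f'' x| ≤ M) {x y : ℝ} (hx : x ∈ s) (hy : y ∈ s) :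
    |f y - f x - (y - x) * f' x| ≤ M * (y - x) ^ 2 := by
  have hM0 : 0 ≤ M := (abs_nonneg _).trans (hM x hx)
  have hsub : uIcc x y ⊆ s := hs.ordConnected.uIcc_subset hx hy
  -- The mean value inequality applied to `f` minus its tangent at `x`; the factor `1 / 2` is not
  -- needed.
  have key := abs_sub_le_of_hasDerivAt (s := uIcc x y) (convex_uIcc x y)
    (f := fun z => f z - (z - x) * f' x) (f' := fun z => f' z - f' x) (M := M * |y - x|)
    (fun z => by
      have := (hf z).sub (((hasDerivAt_id z).sub_const x).mul_const (f' x))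
      rw [one_mul] at this
      exact this)
    (fun z hz => (abs_sub_le_of_hasDerivAt hs hf' hM hx (hsub hz)).trans
      (mul_le_mul_of_nonneg_left (abs_sub_left_of_mem_uIcc hz) hM0))
    left_mem_uIcc right_mem_uIcc
  calc |f y - f x - (y - x) * f' x|
      = |f y - (y - x) * f' x - (f x - (x - x) * f' x)| := by ring_nf
    _ ≤ M * |y - x| * |y - x| := key
    _ = M * (y - x) ^ 2 := by rw [mul_assoc, abs_mul_abs_self]; ring

theorem hasDerivAt_iteratedDeriv {φ : ℝ → ℝ} (hφ : ContDiff ℝ ∞ φ) (j : ℕ) (x : ℝ) :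
    HasDerivAt (iteratedDeriv j φ) (iteratedDeriv (j + 1) φ x) x := by
  rw [iteratedDeriv_succ]
  exact ((hφ.differentiable_iteratedDeriv j (by exact_mod_cast WithTop.coe_lt_top j)) x).hasDerivAt

theorem contDiff_iteratedDeriv {φ : ℝ → ℝ} (hφ : ContDiff ℝ ∞ φ) (j : ℕ) :
    ContDiff ℝ ∞ (iteratedDeriv j φ) := by
  rw [iteratedDeriv_eq_iterate]
  exact hφ.iterate_deriv j

/-! ### Convolution of a distribution with a smooth function -/

/-- The test function `t ↦ χ(t) g(t)`, with `χ` the cutoff. -/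
noncomputable def cutoffTest (r : ℝ) (g : ℝ → ℝ) (hg : ContDiff ℝ ∞ g) :
    𝓓((⊤ : TopologicalSpace.Opens ℝ), ℝ) where
  toFun t := cutoff r t * g t
  contDiff' := (cutoff r).contDiff.mul hg
  hasCompactSupport' := (cutoff r).hasCompactSupport.mul_right
  tsupport_subset' := fun _ _ => trivial

theorem exists_bound_iteratedFDeriv_cutoff (r : ℝ) (N : ℕ) :
    ∃ A : ℝ, 0 ≤ A ∧ ∀ j ≤ N, ∀ t, ‖iteratedFDeriv ℝ j (cutoff r) t‖ ≤ A := by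
  have h : ∀ j : ℕ, ∃ A : ℝ, ∀ t, ‖iteratedFDeriv ℝ j (cutoff r) t‖ ≤ A := fun j =>
    (((cutoff r).contDiff (n := ⊤)).continuous_iteratedFDeriv
      (by exact_mod_cast le_top)).bounded_above_of_compact_support
      ((cutoff r).hasCompactSupport.iteratedFDeriv j)
  choose A hA using h
  have hA0 : ∀ j, 0 ≤ A j := fun j => (norm_nonneg _).trans (hA j 0)
  refine ⟨∑ j ∈ Finset.range (N + 1), A j, Finset.sum_nonneg fun j _ => hA0 j, fun j hj t => ?_⟩
  exact (hA j t).trans (Finset.single_le_sum (f := A) (fun i _ => hA0 i)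
    (Finset.mem_range.mpr (by omega)))

/-- A pointwise bounded family of distributions is bounded on products of the cutoff with smooth
functions, in terms of finitely many derivatives of these functions on the support of the cutoff. -/
theorem exists_bound_cutoffTest {ι : Type*} (T : ι → 𝓓'((⊤ : TopologicalSpace.Opens ℝ), ℝ))
    (hT : ∀ ψ, ∃ C : ℝ, ∀ i, |T i ψ| ≤ C) (r : ℝ) :
    ∃ (N : ℕ) (C : ℝ), 0 ≤ C ∧ ∀ i (g : ℝ → ℝ) (hg : ContDiff ℝ ∞ g) (B : ℝ), 0 ≤ B →
      (∀ j ≤ N, ∀ t, |t| ≤ |r| + 2 → |iteratedDeriv j g t| ≤ B) →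
      |T i (cutoffTest r g hg)| ≤ C * B := by
  let K : Compacts ℝ := ⟨Metric.closedBall 0 (|r| + 2), isCompact_closedBall _ _⟩
  have hK : (K : Set ℝ) ⊆ (⊤ : Opens ℝ) := fun _ _ => trivial
  let S : ι → 𝓓_{K}(ℝ, ℝ) →L[ℝ] ℝ := fun i =>
    { toFun := fun f => T i (TestFunction.ofSupportedIn hK f)
      map_add' := fun f g => map_add (T i) (TestFunction.ofSupportedIn hK f)
        (TestFunction.ofSupportedIn hK g)
      map_smul' := fun c f => map_smul (T i) c (TestFunction.ofSupportedIn hK f)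
      cont := (T i).continuous.comp (TestFunction.continuous_ofSupportedIn hK) }
  obtain ⟨N, C, hC, h⟩ := ContDiffMapSupportedIn.exists_bound_of_pointwise_bounded S
    (fun f => hT (TestFunction.ofSupportedIn hK f))
  obtain ⟨A, hA0, hA⟩ := exists_bound_iteratedFDeriv_cutoff r N
  refine ⟨N, C * (2 ^ N * A), by positivity, fun i g hg B hB hgB => ?_⟩
  have hzero : EqOn (fun t => cutoff r t * g t) 0 (K : Set ℝ)ᶜ := by
    intro t ht
    have h1 : cutoff r t = 0 := by
      refine (cutoff r).zero_of_le_dist ?_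
      have : ¬ dist t 0 ≤ |r| + 2 := ht
      exact (not_le.mp this).le
    simp [h1]
  have := h i ⟨fun t => cutoff r t * g t, (cutoff r).contDiff.mul hg, hzero⟩ (2 ^ N * A * B)
    (by positivity) ?_
  · calc _ ≤ C * (2 ^ N * A * B) := this
      _ = _ := by ring
  intro j hj t ht
  have ht' : |t| ≤ |r| + 2 := mem_closedBall_zero_iff.mp ht
  refine (norm_iteratedFDeriv_mul_le (𝕜 := ℝ) (N := ∞) (f := cutoff r) (g := g)
    (cutoff r).contDiff hg t (n := j) (by exact_mod_cast le_top)).trans ?_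
  calc ∑ i ∈ Finset.range (j + 1), (j.choose i : ℝ) * ‖iteratedFDeriv ℝ i (cutoff r) t‖ *
        ‖iteratedFDeriv ℝ (j - i) g t‖
      ≤ ∑ i ∈ Finset.range (j + 1), (j.choose i : ℝ) * A * B := by
        refine Finset.sum_le_sum fun i hi => ?_
        have hi' : i ≤ j := Nat.lt_succ_iff.mp (Finset.mem_range.mp hi)
        have h2 : ‖iteratedFDeriv ℝ (j - i) g t‖ ≤ B := by
          rw [norm_iteratedFDeriv_eq_norm_iteratedDeriv]
          exact hgB _ (by omega) t ht'
        have h1 := hA i (by omega) t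
        gcongr
    _ = 2 ^ j * A * B := by
        rw [← Finset.sum_mul, ← Finset.sum_mul]
        have := Nat.sum_range_choose j
        rw [← Nat.cast_sum, this]; push_cast; ring
    _ ≤ 2 ^ N * A * B := by
        gcongr
        norm_num

/-- The error of the linear approximation is `T` tested on the first-order Taylor remainder of `φ`.
All derivatives of that remainder are `O((y - s)²)` on compact sets, and `T` has finite order on the
support of the cutoff. -/
theorem hasDerivAt_smoothConv (r : ℝ) (T : 𝓓'((⊤ : TopologicalSpace.Opens ℝ), ℝ)) (φ : ℝ → ℝ)
    (hφ : ContDiff ℝ ∞ φ) (hφ' : ContDiff ℝ ∞ (deriv φ)) (s : ℝ) :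
    HasDerivAt (smoothConv r T φ hφ) (smoothConv r T (deriv φ) hφ' s) s := by
  obtain ⟨N, C, hC, hT⟩ := exists_bound_cutoffTest (fun _ : Unit => T)
    (fun ψ => ⟨|T ψ|, fun _ => le_rfl⟩) r
  -- Contains `s - t` and `y - t` whenever `|t| ≤ |r| + 2` and `|y - s| < 1`.
  set I : Set ℝ := Icc (-(|s| + |r| + 3)) (|s| + |r| + 3) with hI
  have hM : ∀ j, ∃ M : ℝ, ∀ x ∈ I, |iteratedDeriv (j + 2) φ x| ≤ M := fun j =>
    isCompact_Icc.exists_bound_of_continuousOn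
      (contDiff_iteratedDeriv hφ (j + 2)).continuous.continuousOn
  choose M hM using hM
  have hM0 : ∀ j, 0 ≤ M j := fun j => (abs_nonneg _).trans (hM j 0 (by
    rw [hI]; constructor <;> linarith [abs_nonneg s, abs_nonneg r]))
  set M' := ∑ j ∈ Finset.range (N + 1), M j with hM'
  have hM'0 : 0 ≤ M' := Finset.sum_nonneg fun j _ => hM0 j
  have hMM' : ∀ j ≤ N, M j ≤ M' := fun j hj =>
    Finset.single_le_sum (f := M) (fun i _ => hM0 i) (Finset.mem_range.mpr (by omega))
  rw [← hasDerivWithinAt_univ]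
  refine hasDerivWithinAt_of_modulus (m := fun y => C * M' * |y - s|) ?_ ?_
  · have : Continuous fun y => C * M' * |y - s| := by fun_prop
    rw [nhdsWithin_univ]
    simpa using this.tendsto s
  rw [nhdsWithin_univ]
  filter_upwards [Metric.ball_mem_nhds s one_pos] with y hy
  rw [Metric.mem_ball, Real.dist_eq] at hy
  set F : ℝ → ℝ := fun z => φ (z + (y - s)) - φ z - (y - s) * deriv φ z with hF
  have hFc : ContDiff ℝ ∞ F := ((hφ.comp (contDiff_id.add contDiff_const)).sub hφ).sub
    (contDiff_const.mul hφ')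
  have hg : ContDiff ℝ ∞ fun t => F (s - t) := hFc.comp (contDiff_const.sub contDiff_id)
  have hFj : ∀ j z, iteratedDeriv j F z = iteratedDeriv j φ (z + (y - s)) - iteratedDeriv j φ z
      - (y - s) * iteratedDeriv (j + 1) φ z := by
    intro j
    induction j with
    | zero => intro z; simp [hF, iteratedDeriv_one]
    | succ j ih =>
      intro z
      rw [iteratedDeriv_succ, funext ih]
      have h1 := (hasDerivAt_iteratedDeriv hφ j (z + (y - s))).comp_add_const z (y - s)
      exact ((h1.sub (hasDerivAt_iteratedDeriv hφ j z)).sub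
        ((hasDerivAt_iteratedDeriv hφ (j + 1) z).const_mul (y - s))).deriv
  have hlin : smoothConv r T φ hφ y - smoothConv r T φ hφ s
      - (y - s) * smoothConv r T (deriv φ) hφ' s = T (cutoffTest r (fun t => F (s - t)) hg) := by
    have : cutoffTest r (fun t => F (s - t)) hg = shiftedTest r φ hφ y - shiftedTest r φ hφ s
        - (y - s) • shiftedTest r (deriv φ) hφ' s := by
      ext t
      change cutoff r t * (φ (s - t + (y - s)) - φ (s - t) - (y - s) * deriv φ (s - t))
        = cutoff r t * φ (y - t) - cutoff r t * φ (s - t) - (y - s) * (cutoff r t * deriv φ (s - t))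
      rw [show s - t + (y - s) = y - t by ring]; ring
    rw [this, map_sub, map_sub, map_smul]
    rfl
  rw [hlin]
  have := hT () (fun t => F (s - t)) hg (M' * (y - s) ^ 2) (by positivity) ?_
  · calc _ ≤ C * (M' * (y - s) ^ 2) := this
      _ = _ := by rw [← sq_abs]; ring
  intro j hj t ht
  simp only [iteratedDeriv_comp_const_sub, smul_eq_mul]
  rw [abs_mul, abs_pow, abs_neg, abs_one,
    one_pow, one_mul, hFj]
  have hy' := abs_le.mp hy.le
  have ht' := abs_le.mp ht
  have hs1 := neg_abs_le s
  have hs2 := le_abs_self s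
  have key := abs_taylor_le_of_hasDerivAt (s := I) (convex_Icc _ _) (hasDerivAt_iteratedDeriv hφ j)
    (hasDerivAt_iteratedDeriv hφ (j + 1)) (hM j) (x := s - t) (y := s - t + (y - s))
    (by constructor <;> linarith) (by constructor <;> linarith)
  rw [add_sub_cancel_left] at key
  exact key.trans (mul_le_mul_of_nonneg_right (hMM' j hj) (sq_nonneg _))

theorem smoothConv_congr (r : ℝ) (T : 𝓓'((⊤ : TopologicalSpace.Opens ℝ), ℝ)) {φ ψ : ℝ → ℝ}
    (hφ : ContDiff ℝ ∞ φ) (hψ : ContDiff ℝ ∞ ψ) (h : φ = ψ) :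
    smoothConv r T φ hφ = smoothConv r T ψ hψ := by
  subst h; rfl

theorem iteratedDeriv_smoothConv (r : ℝ) (T : 𝓓'((⊤ : TopologicalSpace.Opens ℝ), ℝ)) (j : ℕ) :
    ∀ (φ : ℝ → ℝ) (hφ : ContDiff ℝ ∞ φ),
      iteratedDeriv j (smoothConv r T φ hφ) =
        smoothConv r T (iteratedDeriv j φ) (contDiff_iteratedDeriv hφ j) := by
  induction j with
  | zero =>
    intro φ hφ
    rw [iteratedDeriv_zero]
    exact smoothConv_congr r T _ _ iteratedDeriv_zero.symm
  | succ j ih =>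
    intro φ hφ
    have hφ' : ContDiff ℝ ∞ (deriv φ) := iteratedDeriv_one (f := φ) ▸ contDiff_iteratedDeriv hφ 1
    rw [iteratedDeriv_succ', funext fun s => (hasDerivAt_smoothConv r T φ hφ hφ' s).deriv,
      ih (deriv φ) hφ']
    exact smoothConv_congr r T _ _ iteratedDeriv_succ'.symm

theorem contDiff_smoothConv (r : ℝ) (T : 𝓓'((⊤ : TopologicalSpace.Opens ℝ), ℝ)) (φ : ℝ → ℝ)
    (hφ : ContDiff ℝ ∞ φ) : ContDiff ℝ ∞ (smoothConv r T φ hφ) := by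
  refine contDiff_of_differentiable_iteratedDeriv fun j _ => ?_
  rw [iteratedDeriv_smoothConv]
  have h := contDiff_iteratedDeriv hφ j
  exact fun s => (hasDerivAt_smoothConv r T _ h
    (iteratedDeriv_one (f := iteratedDeriv j φ) ▸ contDiff_iteratedDeriv h 1) s).differentiableAt

/-- Convolutions of a pointwise bounded family of distributions with `φ` are bounded at the points
`s` of a set on whose translates by `[-|r| - 2, |r| + 2]` all derivatives of `φ` are bounded. -/
theorem exists_bound_smoothConv {ι : Type*} (T : ι → 𝓓'((⊤ : TopologicalSpace.Opens ℝ), ℝ))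
    (hT : ∀ ψ, ∃ C : ℝ, ∀ i, |T i ψ| ≤ C) (r : ℝ) {φ : ℝ → ℝ} (hφ : ContDiff ℝ ∞ φ) (S : Set ℝ)
    (hS : ∀ i : ℕ, ∃ B : ℝ, ∀ s ∈ S, ∀ t, |t| ≤ |r| + 2 → |iteratedDeriv i φ (s - t)| ≤ B) :
    ∃ C : ℝ, 0 ≤ C ∧ ∀ i, ∀ s ∈ S, ∀ j ≤ 2,
      |smoothConv r (T i) (iteratedDeriv j φ) (contDiff_iteratedDeriv hφ j) s| ≤ C := by
  obtain ⟨N, C, hC, h⟩ := exists_bound_cutoffTest T hT r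
  choose B hB using hS
  -- Order `N` of the family plus the two extra derivatives falling on `φ`.
  set B' := ∑ j ∈ Finset.range (N + 3), |B j| with hB'
  have hB'0 : 0 ≤ B' := Finset.sum_nonneg fun j _ => abs_nonneg _
  have hBB' : ∀ j ≤ N + 2, B j ≤ B' := fun j hj => (le_abs_self _).trans
    (Finset.single_le_sum (f := fun j => |B j|) (fun i _ => abs_nonneg _)
      (Finset.mem_range.mpr (by omega)))
  refine ⟨C * B', by positivity, fun i s hs j hj => ?_⟩
  refine h i (fun t => iteratedDeriv j φ (s - t))
    ((contDiff_iteratedDeriv hφ j).comp (contDiff_const.sub contDiff_id)) B' hB'0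
    fun k hk t ht => ?_
  simp only [iteratedDeriv_comp_const_sub, smul_eq_mul]
  rw [abs_mul, abs_pow, abs_neg, abs_one,
    one_pow, one_mul, iteratedDeriv_eq_iterate, iteratedDeriv_eq_iterate,
    ← Function.iterate_add_apply, ← iteratedDeriv_eq_iterate]
  exact (hB (k + j) s hs t ht).trans (hBB' _ (by omega))

/-! ### The density as a function of the renormalized density -/

theorem rhoCr_sq : rhoCr ^ 2 = 1 / 2 := by
  rw [rhoCr, div_pow, Real.sq_sqrt (by norm_num)]; norm_num

theorem rhoCr_pos : 0 < rhoCr := by rw [rhoCr]; positivity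

theorem sq_le_half {τ : ℝ} (h : τ ∈ Icc 0 rhoCr) : τ ^ 2 ≤ 1 / 2 :=
  (pow_le_pow_left₀ h.1 h.2 2).trans_eq rhoCr_sq

theorem continuousOn_nuOf_integrand :
    ContinuousOn (fun τ : ℝ => τ ^ 2 / (1 - τ ^ 2)) (Icc 0 rhoCr) :=
  ContinuousOn.div (by fun_prop) (by fun_prop) fun τ hτ => by linarith [sq_le_half hτ]

theorem uIcc_subset_Icc_rhoCr {a b : ℝ} (ha : a ∈ Icc 0 rhoCr) (hb : b ∈ Icc 0 rhoCr) :
    uIcc a b ⊆ Icc 0 rhoCr := ordConnected_Icc.uIcc_subset ha hb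

theorem nuOf_sub {a b : ℝ} (ha : a ∈ Icc 0 rhoCr) (hb : b ∈ Icc 0 rhoCr) :
    nuOf b - nuOf a = ∫ τ in a..b, τ ^ 2 / (1 - τ ^ 2) := by
  have h0 : (0 : ℝ) ∈ Icc 0 rhoCr := ⟨le_rfl, rhoCr_pos.le⟩
  have hi : ∀ {x}, x ∈ Icc 0 rhoCr →
      IntervalIntegrable (fun τ : ℝ => τ ^ 2 / (1 - τ ^ 2)) volume 0 x := fun hx =>
    (continuousOn_nuOf_integrand.mono (uIcc_subset_Icc_rhoCr h0 hx)).intervalIntegrable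
  exact intervalIntegral.integral_interval_sub_left (hi hb) (hi ha)

theorem nuOf_sub_le {a b : ℝ} (ha : a ∈ Icc 0 rhoCr) (hb : b ∈ Icc 0 rhoCr) (hab : a ≤ b) :
    nuOf b - nuOf a ≤ b - a := by
  rw [nuOf_sub ha hb]
  have h := intervalIntegral.integral_mono_on hab
    (continuousOn_nuOf_integrand.mono (uIcc_subset_Icc_rhoCr ha hb)).intervalIntegrable
    (intervalIntegrable_const (c := (1 : ℝ)) (μ := volume)) fun τ hτ => by
      have := sq_le_half ⟨ha.1.trans hτ.1, hτ.2.trans hb.2⟩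
      rw [div_le_one (by linarith)]; linarith
  simpa using h

/-- The integrand is at least `τ²`, and `b³ - a³ - (b - a)³ = 3ab(b - a) ≥ 0`. This yields both
strict monotonicity of `nuOf` and Hölder continuity of exponent `1 / 3` of its inverse. -/
theorem pow_three_le_nuOf_sub {a b : ℝ} (ha : a ∈ Icc 0 rhoCr) (hb : b ∈ Icc 0 rhoCr)
    (hab : a ≤ b) : (b - a) ^ 3 ≤ 3 * (nuOf b - nuOf a) := by
  rw [nuOf_sub ha hb]
  have h := intervalIntegral.integral_mono_on hab
    ((continuous_pow 2).intervalIntegrable (μ := volume) a b)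
    (continuousOn_nuOf_integrand.mono (uIcc_subset_Icc_rhoCr ha hb)).intervalIntegrable
    fun τ hτ => by
      have := sq_le_half ⟨ha.1.trans hτ.1, hτ.2.trans hb.2⟩
      rw [le_div_iff₀ (by linarith)]; nlinarith [sq_nonneg τ]
  rw [integral_pow] at h
  norm_num at h
  nlinarith [mul_nonneg (mul_nonneg ha.1 hb.1) (sub_nonneg.mpr hab)]

theorem nuOf_zero : nuOf 0 = 0 := by simp [nuOf]

theorem strictMonoOn_nuOf : StrictMonoOn nuOf (Icc 0 rhoCr) := fun a ha b hb hab => by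
  have := pow_three_le_nuOf_sub ha hb hab.le
  have h2 : 0 < (b - a) ^ 3 := pow_pos (sub_pos.mpr hab) 3
  linarith

theorem continuousOn_nuOf : ContinuousOn nuOf (Icc 0 rhoCr) :=
  (intervalIntegral.continuousOn_primitive_interval
    (continuousOn_nuOf_integrand.integrableOn_Icc.mono_set
      (uIcc_subset_Icc_rhoCr ⟨le_rfl, rhoCr_pos.le⟩ ⟨rhoCr_pos.le, le_rfl⟩))).mono
    Icc_subset_uIcc

theorem exists_nuOf_eq {ν : ℝ} (hν : ν ∈ Icc 0 nuCr) : ∃ ρ ∈ Icc 0 rhoCr, nuOf ρ = ν := by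
  have := intermediate_value_Icc rhoCr_pos.le continuousOn_nuOf
  rw [nuOf_zero] at this
  exact this hν

theorem rho_mem {ν : ℝ} (hν : ν ∈ Icc 0 nuCr) : rho ν ∈ Icc 0 rhoCr :=
  Function.invFunOn_mem (exists_nuOf_eq hν)

theorem nuOf_rho {ν : ℝ} (hν : ν ∈ Icc 0 nuCr) : nuOf (rho ν) = ν :=
  Function.invFunOn_eq (exists_nuOf_eq hν)

theorem strictMonoOn_rho : StrictMonoOn rho (Icc 0 nuCr) := fun a ha b hb hab => by
  rwa [← strictMonoOn_nuOf.lt_iff_lt (rho_mem ha) (rho_mem hb), nuOf_rho ha, nuOf_rho hb]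

theorem nuCr_pos : 0 < nuCr := by
  rw [nuCr, ← nuOf_zero]
  exact strictMonoOn_nuOf ⟨le_rfl, rhoCr_pos.le⟩ ⟨rhoCr_pos.le, le_rfl⟩ rhoCr_pos

theorem rho_zero : rho 0 = 0 := by
  have h0 : (0 : ℝ) ∈ Icc 0 nuCr := ⟨le_rfl, nuCr_pos.le⟩
  exact strictMonoOn_nuOf.injOn (rho_mem h0) ⟨le_rfl, rhoCr_pos.le⟩
    ((nuOf_rho h0).trans nuOf_zero.symm)

theorem rho_pos {ν : ℝ} (hν : ν ∈ Ioc 0 nuCr) : 0 < rho ν := by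
  have := strictMonoOn_rho ⟨le_rfl, nuCr_pos.le⟩ ⟨hν.1.le, hν.2⟩ hν.1
  rwa [rho_zero] at this

theorem rho_lt_rhoCr {ν : ℝ} (hν : ν ∈ Ico 0 nuCr) : rho ν < rhoCr := by
  have hc : nuCr ∈ Icc 0 nuCr := ⟨nuCr_pos.le, le_rfl⟩
  exact (strictMonoOn_rho ⟨hν.1, hν.2.le⟩ hc hν.2).trans_le (rho_mem hc).2

/-- This converts the bound `O(ν)` on `H` and its `s`-derivatives into `O(ϱ)`. -/
theorem le_rho {ν : ℝ} (hν : ν ∈ Icc 0 nuCr) : ν ≤ rho ν := by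
  have := nuOf_sub_le ⟨le_rfl, rhoCr_pos.le⟩ (rho_mem hν) (rho_mem hν).1
  rw [nuOf_rho hν, nuOf_zero] at this
  linarith

theorem continuousOn_rho : ContinuousOn rho (Icc 0 nuCr) := by
  have key : ∀ a ∈ Icc 0 nuCr, ∀ b ∈ Icc 0 nuCr, a ≤ b → |rho b - rho a| ^ 3 ≤ 3 * |b - a| := by
    intro a ha b hb hab
    have h := strictMonoOn_rho.monotoneOn ha hb hab
    rw [abs_of_nonneg (sub_nonneg.mpr h), abs_of_nonneg (sub_nonneg.mpr hab)]
    have := pow_three_le_nuOf_sub (rho_mem ha) (rho_mem hb) h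
    rwa [nuOf_rho ha, nuOf_rho hb] at this
  rw [Metric.continuousOn_iff]
  intro b hb ε hε
  refine ⟨ε ^ 3 / 3, by positivity, fun a ha hab => ?_⟩
  rw [Real.dist_eq] at hab ⊢
  have h : |rho a - rho b| ^ 3 ≤ 3 * |a - b| := by
    rcases le_total a b with hle | hle
    · rw [abs_sub_comm, abs_sub_comm a]; exact key a ha b hb hle
    · exact key b hb a ha hle
  exact lt_of_pow_lt_pow_left₀ 3 hε.le (by linarith)

/-! ### The characteristic speed and the coefficient of the equation -/

theorem mach_sq {ρ : ℝ} (hρ : ρ ∈ Icc 0 rhoCr) : mach ρ ^ 2 = (1 - ρ ^ 2) / ρ ^ 2 := by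
  rw [mach, div_pow, Real.sq_sqrt]
  linarith [sq_le_half hρ]

theorem mach_sq_sub_one {ρ : ℝ} (hρ : ρ ∈ Ioc 0 rhoCr) :
    mach ρ ^ 2 - 1 = (1 - 2 * ρ ^ 2) / ρ ^ 2 := by
  have := hρ.1.ne'
  rw [mach_sq ⟨hρ.1.le, hρ.2⟩]; field_simp; ring

theorem waveCoeff_eq {ν : ℝ} (hν : ν ∈ Ioc 0 nuCr) :
    waveCoeff ν = (1 - 2 * rho ν ^ 2) / rho ν ^ 4 := by
  rw [waveCoeff, mach_sq_sub_one ⟨rho_pos hν, (rho_mem ⟨hν.1.le, hν.2⟩).2⟩, div_div]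
  ring_nf

theorem waveCoeff_pos {ν : ℝ} (hν : ν ∈ Ioo 0 nuCr) : 0 < waveCoeff ν := by
  rw [waveCoeff_eq ⟨hν.1, hν.2.le⟩]
  have h1 := rho_pos ⟨hν.1, hν.2.le⟩
  have h2 := rho_lt_rhoCr ⟨hν.1.le, hν.2⟩
  have h3 : rho ν ^ 2 < 1 / 2 := (pow_lt_pow_left₀ h2 h1.le two_ne_zero).trans_eq rhoCr_sq
  exact div_pos (by linarith) (by positivity)

theorem antitoneOn_waveCoeff : AntitoneOn waveCoeff (Ioc 0 nuCr) := by
  intro a ha b hb hab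
  rw [waveCoeff_eq ha, waveCoeff_eq hb]
  have h := strictMonoOn_rho.monotoneOn ⟨ha.1.le, ha.2⟩ ⟨hb.1.le, hb.2⟩ hab
  have h1 := rho_pos ha
  have h2 := sq_le_half (rho_mem ⟨ha.1.le, ha.2⟩)
  have h3 : rho a ^ 2 ≤ rho b ^ 2 := by gcongr
  exact div_le_div₀ (by linarith) (by linarith) (by positivity) (by gcongr)

theorem continuousOn_waveCoeff : ContinuousOn waveCoeff (Ioc 0 nuCr) := by
  have hr : ContinuousOn rho (Ioc 0 nuCr) := continuousOn_rho.mono Ioc_subset_Icc_self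
  refine ContinuousOn.congr (f := fun ν => (1 - 2 * rho ν ^ 2) / rho ν ^ 4) ?_
    fun ν hν => waveCoeff_eq hν
  exact ContinuousOn.div (continuousOn_const.sub (continuousOn_const.mul (hr.pow 2))) (hr.pow 4)
    fun ν hν => pow_ne_zero _ (rho_pos hν).ne'

theorem continuousOn_charSpeed_integrand :
    ContinuousOn (fun τ : ℝ => √(1 - 2 * τ ^ 2) / (1 - τ ^ 2)) (Icc 0 rhoCr) :=
  ContinuousOn.div (by fun_prop) (by fun_prop) fun τ hτ => by linarith [sq_le_half hτ]

/-- In the variable `ϱ` the singularity at vacuum cancels, leaving an integrand continuous on `[0,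
ϱ_cr]`. -/
theorem charSpeed_eq {ν : ℝ} (hν : ν ∈ Icc 0 nuCr) :
    charSpeed ν = ∫ τ in (0 : ℝ)..rho ν, √(1 - 2 * τ ^ 2) / (1 - τ ^ 2) := by
  have hρ := rho_mem hν
  refine intervalIntegral.integral_congr_ae (Eventually.of_forall fun τ hτ => ?_)
  rw [uIoc_of_le hρ.1] at hτ
  have hτ' : τ ∈ Ioc 0 rhoCr := ⟨hτ.1, hτ.2.trans hρ.2⟩
  have h1 := sq_le_half ⟨hτ'.1.le, hτ'.2⟩
  have h2 : 1 - τ ^ 2 ≠ 0 := by linarith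
  have h3 := hτ'.1.ne'
  rw [mach_sq_sub_one hτ', mach_sq ⟨hτ'.1.le, hτ'.2⟩, Real.sqrt_div (by linarith),
    Real.sqrt_sq hτ'.1.le]
  field_simp

theorem charSpeed_sub {a b : ℝ} (ha : a ∈ Icc 0 nuCr) (hb : b ∈ Icc 0 nuCr) :
    charSpeed b - charSpeed a = ∫ τ in rho a..rho b, √(1 - 2 * τ ^ 2) / (1 - τ ^ 2) := by
  have h0 : (0 : ℝ) ∈ Icc 0 rhoCr := ⟨le_rfl, rhoCr_pos.le⟩
  have hi : ∀ {x}, x ∈ Icc 0 rhoCr → IntervalIntegrable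
      (fun τ : ℝ => √(1 - 2 * τ ^ 2) / (1 - τ ^ 2)) volume 0 x := fun hx =>
    (continuousOn_charSpeed_integrand.mono (uIcc_subset_Icc_rhoCr h0 hx)).intervalIntegrable
  rw [charSpeed_eq ha, charSpeed_eq hb]
  exact intervalIntegral.integral_interval_sub_left (hi (rho_mem hb)) (hi (rho_mem ha))

theorem charSpeed_zero : charSpeed 0 = 0 := by simp [charSpeed, rho_zero]

theorem continuousOn_charSpeed : ContinuousOn charSpeed (Icc 0 nuCr) := by
  have h : ContinuousOn (fun x => ∫ τ in (0 : ℝ)..x, √(1 - 2 * τ ^ 2) / (1 - τ ^ 2))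
      (Icc 0 rhoCr) :=
    (intervalIntegral.continuousOn_primitive_interval
      (continuousOn_charSpeed_integrand.integrableOn_Icc.mono_set
        (uIcc_subset_Icc_rhoCr ⟨le_rfl, rhoCr_pos.le⟩ ⟨rhoCr_pos.le, le_rfl⟩))).mono
      Icc_subset_uIcc
  exact (h.comp continuousOn_rho fun ν hν => rho_mem hν).congr fun ν hν => charSpeed_eq hν

/-- Since `k'` decreases, `k` grows at least at its right-endpoint slope. Comparing integrands in
the variable `ϱ` covers `a = 0`, where `k'` is infinite. -/
theorem mul_sqrt_waveCoeff_le {a b : ℝ} (ha : 0 ≤ a) (hb : b ≤ nuCr) (hab : a ≤ b) (hb0 : 0 < b) :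
    (b - a) * √(waveCoeff b) ≤ charSpeed b - charSpeed a := by
  have ha' : a ∈ Icc 0 nuCr := ⟨ha, hab.trans hb⟩
  have hb' : b ∈ Icc 0 nuCr := ⟨hb0.le, hb⟩
  have hρa := rho_mem ha'
  have hρb := rho_mem hb'
  have hpos := rho_pos ⟨hb0, hb⟩
  have hν : b - a = ∫ τ in rho a..rho b, τ ^ 2 / (1 - τ ^ 2) := by
    rw [← nuOf_sub hρa hρb, nuOf_rho ha', nuOf_rho hb']
  rw [charSpeed_sub ha' hb', hν, ← intervalIntegral.integral_mul_const]
  refine intervalIntegral.integral_mono_on (strictMonoOn_rho.monotoneOn ha' hb' hab)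
    ((continuousOn_nuOf_integrand.mono
      (uIcc_subset_Icc_rhoCr hρa hρb)).intervalIntegrable (μ := volume) |>.mul_const _)
    (continuousOn_charSpeed_integrand.mono (uIcc_subset_Icc_rhoCr hρa hρb)).intervalIntegrable ?_
  intro τ hτ
  have hτ0 : 0 ≤ τ := hρa.1.trans hτ.1
  have h1 := sq_le_half ⟨hτ0, hτ.2.trans hρb.2⟩
  have h2 : 0 < 1 - τ ^ 2 := by linarith
  rw [waveCoeff_eq ⟨hb0, hb⟩, Real.sqrt_div (by linarith [sq_le_half hρb]),
    show rho b ^ 4 = (rho b ^ 2) ^ 2 by ring, Real.sqrt_sq (by positivity), div_mul_eq_mul_div]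
  refine div_le_div_of_nonneg_right ?_ h2.le
  have h3 : τ ^ 2 ≤ rho b ^ 2 := pow_le_pow_left₀ hτ0 hτ.2 2
  have h4 : √(1 - 2 * rho b ^ 2) ≤ √(1 - 2 * τ ^ 2) := Real.sqrt_le_sqrt (by linarith)
  calc τ ^ 2 * (√(1 - 2 * rho b ^ 2) / rho b ^ 2)
      = (τ ^ 2 / rho b ^ 2) * √(1 - 2 * rho b ^ 2) := by ring
    _ ≤ 1 * √(1 - 2 * τ ^ 2) := by
        refine mul_le_mul ?_ h4 (Real.sqrt_nonneg _) zero_le_one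
        rwa [div_le_one (by positivity)]
    _ = _ := one_mul _

/-! ### The estimates -/

section Estimates

variable {νs : ℝ} {H Hν : ℝ → 𝓓'((⊤ : TopologicalSpace.Opens ℝ), ℝ)}

theorem IsRegularKernel.exists_bound_deriv (h : IsRegularKernel νs H Hν)
    (ψ : 𝓓((⊤ : TopologicalSpace.Opens ℝ), ℝ)) :
    ∃ C : ℝ, ∀ ν : Icc 0 νs, |Hν ν ψ| ≤ C := by
  obtain ⟨C, hC⟩ := isCompact_Icc.exists_bound_of_continuousOn (h.continuous_deriv ψ)
  exact ⟨C, fun ν => hC ν ν.2⟩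

theorem IsRegularKernel.abs_le (h : IsRegularKernel νs H Hν)
    {ψ : 𝓓((⊤ : TopologicalSpace.Opens ℝ), ℝ)} {C : ℝ} (hC : ∀ ν : Icc 0 νs, |Hν ν ψ| ≤ C)
    {ν : ℝ} (hν : ν ∈ Icc 0 νs) : |H ν ψ| ≤ C * ν := by
  have := (convex_Icc 0 νs).norm_image_sub_le_of_norm_hasDerivWithin_le (h.hasDeriv ψ)
    (fun t ht => hC ⟨t, ht⟩) ⟨le_rfl, hν.1.trans hν.2⟩ hν
  rw [h.init, sub_zero, Real.norm_eq_abs, Real.norm_eq_abs, abs_of_nonneg hν.1] at this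
  simpa using this

theorem IsRegularKernel.exists_estimates (h : IsRegularKernel νs H Hν) (hνs : νs ≤ nuCr)
    {φ : ℝ → ℝ} (hφ : ContDiff ℝ ∞ φ) (S : Set ℝ)
    (hS : ∀ i : ℕ, ∃ B : ℝ, ∀ s ∈ S, ∀ t, |t| ≤ |charSpeed νs| + 2 →
      |iteratedDeriv i φ (s - t)| ≤ B) :
    ∃ C > 0, ∀ ν ∈ Icc 0 νs, ∀ s ∈ S, EstimatesAt νs H Hν φ hφ C ν s := by
  set r := charSpeed νs
  obtain ⟨C₀, h₀, hC₀⟩ := exists_bound_smoothConv (fun ν : Icc 0 νs => Hν ν)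
    h.exists_bound_deriv r hφ S hS
  obtain ⟨C₁, h₁, hC₁⟩ := exists_bound_smoothConv (fun ν : Icc 0 νs => ∂_{(1 : ℝ)} (Hν ν))
    (fun ψ => by
      simpa only [Distribution.lineDerivOp_apply_apply] using
        h.exists_bound_deriv (-∂_{(1 : ℝ)} ψ)) r hφ S hS
  obtain ⟨C₂, h₂, hC₂⟩ := exists_bound_smoothConv
    (fun ν : Icc 0 νs => ∂_{(1 : ℝ)} (∂_{(1 : ℝ)} (Hν ν)))
    (fun ψ => by
      simpa only [Distribution.lineDerivOp_apply_apply] using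
        h.exists_bound_deriv (-∂_{(1 : ℝ)} (-∂_{(1 : ℝ)} ψ))) r hφ S hS
  -- The constants bound the convolutions of `H_ν`, `∂_s H_ν`, `∂_s² H_ν`; the `1` only ensures
  -- positivity.
  refine ⟨C₀ + C₁ + C₂ + 1, by positivity, fun ν hν s hs j hj => ?_⟩
  have hν' : ν ∈ Icc 0 nuCr := ⟨hν.1, hν.2.trans hνs⟩
  have hρ := rho_mem hν'
  have hρ1 : rho ν ≤ 1 := by nlinarith [sq_le_half hρ, hρ.1]
  have hνρ := le_rho hν'
  have e₀ := hC₀ ⟨ν, hν⟩ s hs j hj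
  rw [iteratedDeriv_smoothConv, iteratedDeriv_smoothConv, iteratedDeriv_smoothConv]
  set ψ := shiftedTest r (iteratedDeriv j φ) (contDiff_iteratedDeriv hφ j) s with hψ
  have e₁ : |(∂_{(1 : ℝ)} (H ν)) ψ| ≤ C₁ * ν := by
    rw [Distribution.lineDerivOp_apply_apply]
    refine h.abs_le (fun t => ?_) hν
    -- The `s`-derivative is moved to the test function to integrate in `ν`, then back onto `H_ν`,
    -- where `C₁` applies.
    rw [← Distribution.lineDerivOp_apply_apply]
    exact hC₁ t s hs j hj
  have e₂ : |(∂_{(1 : ℝ)} (∂_{(1 : ℝ)} (H ν))) ψ| ≤ C₂ * ν := by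
    rw [Distribution.lineDerivOp_apply_apply, Distribution.lineDerivOp_apply_apply]
    refine h.abs_le (fun t => ?_) hν
    rw [← Distribution.lineDerivOp_apply_apply, ← Distribution.lineDerivOp_apply_apply]
    exact hC₂ t s hs j hj
  have e₀' : |rho ν * Hν ν ψ| ≤ C₀ * rho ν := by
    rw [abs_mul, abs_of_nonneg hρ.1, mul_comm]
    exact mul_le_mul_of_nonneg_right e₀ hρ.1
  constructor
  · change |rho ν * Hν ν ψ + (∂_{(1 : ℝ)} (∂_{(1 : ℝ)} (H ν))) ψ| ≤ _
    calc _ ≤ C₀ * rho ν + C₂ * ν := (abs_add_le _ _).trans (add_le_add e₀' e₂)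
      _ ≤ C₀ * rho ν + C₂ * rho ν := by gcongr
      _ ≤ (C₀ + C₁ + C₂ + 1) * rho ν := by nlinarith [hρ.1, mul_nonneg h₁ hρ.1]
  · change |rho ν * Hν ν ψ| + |(∂_{(1 : ℝ)} (H ν)) ψ| ≤ _
    have : C₁ * ν ≤ C₁ * 1 := by gcongr; exact hνρ.trans hρ1
    have : C₀ * rho ν ≤ C₀ * 1 := by gcongr
    linarith

end Estimates

/-! ### A persistent random walk

The pair of linear forms `(P, Q)` below is the expectation of the endpoint of a random walk on the
line whose `n`-th step has length `η / c n` and which reverses its direction with probability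
`(1 - c n / c (n + 1)) / 2`, according to the direction of its last step. -/

/-- The two directional expectations of the persistent random walk. -/
noncomputable def telegraph (c : ℕ → ℝ) (η : ℝ) :
    ℕ → ((ℝ → ℝ) →ₗ[ℝ] ℝ) × ((ℝ → ℝ) →ₗ[ℝ] ℝ)
  | 0 => (LinearMap.proj 0, LinearMap.proj 0)
  | n + 1 =>
    let A := (telegraph c η n).1 ∘ₗ LinearMap.funLeft ℝ ℝ fun x => x + η / c n
    let B := (telegraph c η n).2 ∘ₗ LinearMap.funLeft ℝ ℝ fun x => x + -(η / c n)
    let θ := c n / c (n + 1)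
    (((1 + θ) / 2) • A + ((1 - θ) / 2) • B, ((1 - θ) / 2) • A + ((1 + θ) / 2) • B)

/-- The mean of the two directional expectations. -/
noncomputable def walkMean (c : ℕ → ℝ) (η : ℝ) (n : ℕ) : (ℝ → ℝ) →ₗ[ℝ] ℝ :=
  (1 / 2 : ℝ) • ((telegraph c η n).1 + (telegraph c η n).2)

/-- The rescaled difference of the two directional expectations. -/
noncomputable def walkFlux (c : ℕ → ℝ) (η : ℝ) (n : ℕ) : (ℝ → ℝ) →ₗ[ℝ] ℝ :=
  c n • ((telegraph c η n).1 - (telegraph c η n).2)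

/-- `f` is bounded by `K` and `K`-Lipschitz. -/
structure BddLip (f : ℝ → ℝ) (K : ℝ) : Prop where
  bdd : ∀ x, |f x| ≤ K
  lip : ∀ x h, |f (x + h) - f x| ≤ K * |h|

/-- `f` and its derivative `f'` are bounded and Lipschitz, with a quadratic Taylor remainder. -/
structure TaylorBound (f f' : ℝ → ℝ) (K : ℝ) : Prop where
  left : BddLip f K
  right : BddLip f' K
  taylor : ∀ x h, |f (x + h) - f x - h * f' x| ≤ K * h ^ 2

theorem abs_sub_sub_le_of_steps {u : ℕ → ℝ} {m n : ℕ} (hmn : m ≤ n) {g e : ℝ}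
    (h : ∀ j, m ≤ j → j < n → |u (j + 1) - u j - g| ≤ e) :
    |u n - u m - (n - m) * g| ≤ (n - m) * e := by
  induction n, hmn using Nat.le_induction with
  | base => simp
  | succ n hmn ih =>
    have h1 := ih fun j hj hjn => h j hj (by omega)
    have h2 := h n hmn (by omega)
    rw [abs_le] at h1 h2 ⊢
    push_cast
    constructor <;> linarith [h1.1, h1.2, h2.1, h2.2]

section Walk

variable {c : ℕ → ℝ} {η : ℝ}

theorem walkMean_zero (f : ℝ → ℝ) : walkMean c η 0 f = f 0 := by
  simp [walkMean, telegraph]; ring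

theorem walkFlux_zero (f : ℝ → ℝ) : walkFlux c η 0 f = 0 := by
  simp [walkFlux, telegraph]

theorem walkMean_succ (n : ℕ) (f : ℝ → ℝ) :
    walkMean c η (n + 1) f = ((telegraph c η n).1 (fun x => f (x + η / c n)) +
      (telegraph c η n).2 (fun x => f (x + -(η / c n)))) / 2 := by
  simp only [walkMean, telegraph, LinearMap.add_apply, LinearMap.smul_apply, LinearMap.comp_apply,
    smul_eq_mul]
  change _ = ((telegraph c η n).1 (LinearMap.funLeft ℝ ℝ (fun x => x + η / c n) f) +
      (telegraph c η n).2 (LinearMap.funLeft ℝ ℝ (fun x => x + -(η / c n)) f)) / 2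
  ring

/-- Turning multiplies the difference of the two forms by `c n / c (n + 1)`, which the new weight `c
(n + 1)` undoes exactly. The flux thus changes only through the shifts, and no derivative of `c`
appears. -/
theorem walkFlux_succ (hc : ∀ n, 0 < c n) (n : ℕ) (f : ℝ → ℝ) :
    walkFlux c η (n + 1) f = c n * ((telegraph c η n).1 (fun x => f (x + η / c n)) -
      (telegraph c η n).2 (fun x => f (x + -(η / c n)))) := by
  have h := (hc (n + 1)).ne'
  simp only [walkFlux, telegraph, LinearMap.add_apply, LinearMap.sub_apply, LinearMap.smul_apply,
    LinearMap.comp_apply, smul_eq_mul]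
  change _ = c n * ((telegraph c η n).1 (LinearMap.funLeft ℝ ℝ (fun x => x + η / c n) f) -
      (telegraph c η n).2 (LinearMap.funLeft ℝ ℝ (fun x => x + -(η / c n)) f))
  field_simp
  ring

/-- `X` majorizes the distance travelled; it will be the characteristic speed at the grid points. -/
theorem sum_steps_le (hc : ∀ n, 0 < c n) (hη : 0 < η) {X : ℕ → ℝ} {m n : ℕ} (hmn : m ≤ n)
    (hX : ∀ j, j < n → η / c j ≤ X (j + 1) - X j) :
    ∑ j ∈ Finset.range n, η / c j ≤ X n - X 0 ∧ X m ≤ X n := by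
  constructor
  · rw [← Finset.sum_range_sub]
    exact Finset.sum_le_sum fun j hj => hX j (Finset.mem_range.mp hj)
  · induction n, hmn using Nat.le_induction with
    | base => rfl
    | succ n hmn ih =>
      linarith [ih fun j hj => hX j (by omega), hX n (by omega), div_pos hη (hc n)]

variable (hc : ∀ n, 0 < c n) (hmono : Monotone c) (hη : 0 < η)

include hc hmono hη

/-- The walk has finite speed, and its transition probabilities are nonnegative. -/
theorem telegraph_abs_le (n : ℕ) : ∀ {f : ℝ → ℝ} {C : ℝ},
    (∀ x, |x| ≤ ∑ j ∈ Finset.range n, η / c j → |f x| ≤ C) →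
      |(telegraph c η n).1 f| ≤ C ∧ |(telegraph c η n).2 f| ≤ C := by
  induction n with
  | zero => intro f C h; exact ⟨h 0 (by simp), h 0 (by simp)⟩
  | succ n ih =>
    intro f C h
    have hδ : 0 ≤ η / c n := (div_pos hη (hc n)).le
    rw [Finset.sum_range_succ] at h
    have hA := (@ih (fun x => f (x + η / c n)) C fun x hx => h _
      ((abs_add_le _ _).trans (by rw [abs_of_nonneg hδ]; linarith))).1
    have hB := (@ih (fun x => f (x + -(η / c n))) C fun x hx => h _
      ((abs_add_le _ _).trans (by rw [abs_neg, abs_of_nonneg hδ]; linarith))).2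
    have hθ0 : 0 ≤ c n / c (n + 1) := (div_pos (hc n) (hc _)).le
    -- Monotonicity of `c` makes the turning step a convex combination.
    have hθ1 : c n / c (n + 1) ≤ 1 := (div_le_one (hc _)).mpr (hmono n.le_succ)
    have key : ∀ {a b p q : ℝ}, |a| ≤ C → |b| ≤ C → 0 ≤ p → 0 ≤ q → p + q = 1 →
        |p * a + q * b| ≤ C := by
      intro a b p q ha hb hp hq hpq
      calc |p * a + q * b| ≤ p * |a| + q * |b| := by
            refine (abs_add_le _ _).trans_eq ?_
            rw [abs_mul, abs_mul, abs_of_nonneg hp, abs_of_nonneg hq]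
        _ ≤ p * C + q * C := by gcongr
        _ = C := by rw [← add_mul, hpq, one_mul]
    exact ⟨key hA hB (by linarith) (by linarith) (by ring),
      key hA hB (by linarith) (by linarith) (by ring)⟩

theorem telegraph_abs_le_of_bdd (n : ℕ) {f : ℝ → ℝ} {C : ℝ} (h : ∀ x, |f x| ≤ C) :
    |(telegraph c η n).1 f| ≤ C ∧ |(telegraph c η n).2 f| ≤ C :=
  telegraph_abs_le hc hmono hη n fun x _ => h x

theorem walkMean_abs_le (n : ℕ) {f : ℝ → ℝ} {C : ℝ}
    (h : ∀ x, |x| ≤ ∑ j ∈ Finset.range n, η / c j → |f x| ≤ C) : |walkMean c η n f| ≤ C := by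
  obtain ⟨h1, h2⟩ := telegraph_abs_le hc hmono hη n h
  simp only [walkMean, LinearMap.smul_apply, LinearMap.add_apply, smul_eq_mul]
  rw [abs_le] at *
  constructor <;> linarith [h1.1, h1.2, h2.1, h2.2]

theorem telegraph_shift (n : ℕ) {f : ℝ → ℝ} {K : ℝ} (hf : BddLip f K) :
    |(telegraph c η n).1 (fun x => f (x + η / c n)) - (telegraph c η n).1 f| ≤ K * (η / c n) ∧
    |(telegraph c η n).2 (fun x => f (x + -(η / c n))) - (telegraph c η n).2 f|
      ≤ K * (η / c n) := by
  have hδ : 0 ≤ η / c n := (div_pos hη (hc n)).le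
  rw [← map_sub, ← map_sub]
  refine ⟨(telegraph_abs_le_of_bdd hc hmono hη n fun x => ?_).1,
    (telegraph_abs_le_of_bdd hc hmono hη n fun x => ?_).2⟩
  · simpa [abs_of_nonneg hδ] using hf.lip x (η / c n)
  · simpa [abs_of_nonneg hδ] using hf.lip x (-(η / c n))

theorem telegraph_shift_taylor (n : ℕ) {f f' : ℝ → ℝ} {K : ℝ} (hf : TaylorBound f f' K) :
    |(telegraph c η n).1 (fun x => f (x + η / c n)) - (telegraph c η n).1 f
      - η / c n * (telegraph c η n).1 f'| ≤ K * (η / c n) ^ 2 ∧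
    |(telegraph c η n).2 (fun x => f (x + -(η / c n))) - (telegraph c η n).2 f
      + η / c n * (telegraph c η n).2 f'| ≤ K * (η / c n) ^ 2 := by
  have e : ∀ a b : ℝ, a + η / c n * b = a - (-(η / c n)) * b := fun a b => by ring
  rw [e, ← smul_eq_mul (η / c n), ← smul_eq_mul (-(η / c n)), ← map_smul, ← map_smul, ← map_sub,
    ← map_sub, ← map_sub, ← map_sub]
  refine ⟨(telegraph_abs_le_of_bdd hc hmono hη n fun x => ?_).1,
    (telegraph_abs_le_of_bdd hc hmono hη n fun x => ?_).2⟩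
  · exact hf.taylor x (η / c n)
  · simpa using hf.taylor x (-(η / c n))

theorem walkMean_step (n : ℕ) {f : ℝ → ℝ} {K : ℝ} (hf : BddLip f K) :
    |walkMean c η (n + 1) f - walkMean c η n f| ≤ K * (η / c n) := by
  obtain ⟨h1, h2⟩ := telegraph_shift hc hmono hη n hf
  rw [walkMean_succ]
  simp only [walkMean, LinearMap.smul_apply, LinearMap.add_apply, smul_eq_mul]
  rw [abs_le] at *
  constructor <;> linarith [h1.1, h1.2, h2.1, h2.2]

theorem walkMean_step_taylor (n : ℕ) {f f' : ℝ → ℝ} {K : ℝ} (hf : TaylorBound f f' K) :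
    |walkMean c η (n + 1) f - walkMean c η n f - η / 2 * (1 / c n ^ 2 * walkFlux c η n f')|
      ≤ K * (η / c n) ^ 2 := by
  obtain ⟨h1, h2⟩ := telegraph_shift_taylor hc hmono hη n hf
  have hn := (hc n).ne'
  have e : η / 2 * (1 / c n ^ 2 * walkFlux c η n f') =
      (η / c n * (telegraph c η n).1 f' - η / c n * (telegraph c η n).2 f') / 2 := by
    simp only [walkFlux, LinearMap.smul_apply, LinearMap.sub_apply, smul_eq_mul]
    field_simp
  rw [e, walkMean_succ]
  simp only [walkMean, LinearMap.smul_apply, LinearMap.add_apply, smul_eq_mul]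
  rw [abs_le] at *
  constructor <;> linarith [h1.1, h1.2, h2.1, h2.2]

theorem walkFlux_step (n : ℕ) {f : ℝ → ℝ} {K : ℝ} (hf : BddLip f K) :
    |walkFlux c η (n + 1) f - walkFlux c η n f| ≤ 2 * η * K := by
  obtain ⟨h1, h2⟩ := telegraph_shift hc hmono hη n hf
  have hn := hc n
  rw [walkFlux_succ hc]
  simp only [walkFlux, LinearMap.smul_apply, LinearMap.sub_apply, smul_eq_mul]
  rw [← mul_sub, abs_mul, abs_of_pos hn]
  have e : 2 * η * K = c n * (2 * (K * (η / c n))) := by field_simp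
  rw [e]
  refine mul_le_mul_of_nonneg_left ?_ hn.le
  rw [abs_le] at *
  constructor <;> linarith [h1.1, h1.2, h2.1, h2.2]

theorem walkFlux_step_taylor (n : ℕ) {f f' : ℝ → ℝ} {K : ℝ} (hf : TaylorBound f f' K) :
    |walkFlux c η (n + 1) f - walkFlux c η n f - 2 * η * walkMean c η n f'|
      ≤ 2 * η * K * (η / c n) := by
  obtain ⟨h1, h2⟩ := telegraph_shift_taylor hc hmono hη n hf
  have hn := hc n
  have e : 2 * η * walkMean c η n f' = c n * (η / c n * (telegraph c η n).1 f' +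
      η / c n * (telegraph c η n).2 f') := by
    simp only [walkMean, LinearMap.smul_apply, LinearMap.add_apply, smul_eq_mul]
    field_simp
  have e' : 2 * η * K * (η / c n) = c n * (2 * (K * (η / c n) ^ 2)) := by field_simp
  rw [e, e', walkFlux_succ hc]
  simp only [walkFlux, LinearMap.smul_apply, LinearMap.sub_apply, smul_eq_mul]
  rw [← mul_sub, ← mul_sub, abs_mul, abs_of_pos hn]
  refine mul_le_mul_of_nonneg_left ?_ hn.le
  rw [abs_le] at *
  constructor <;> linarith [h1.1, h1.2, h2.1, h2.2]

theorem walkFlux_sub_abs_le {m n : ℕ} (hmn : m ≤ n) {f : ℝ → ℝ} {K : ℝ} (hf : BddLip f K) :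
    |walkFlux c η n f - walkFlux c η m f| ≤ (n - m) * (2 * η * K) := by
  have := abs_sub_sub_le_of_steps (u := fun n => walkFlux c η n f) hmn (g := 0)
    (e := 2 * η * K) fun j _ _ => by simpa using walkFlux_step hc hmono hη j hf
  simpa using this

theorem walkFlux_abs_le (n : ℕ) {f : ℝ → ℝ} {K : ℝ} (hf : BddLip f K) :
    |walkFlux c η n f| ≤ n * (2 * η * K) := by
  simpa [walkFlux_zero] using walkFlux_sub_abs_le hc hmono hη (Nat.zero_le n) hf

/-- The modulus involves `X` and not `1 / c ^ 2`, so in the limit it gives continuity up to `ν = 0`,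
where the coefficient is unbounded. -/
theorem walkMean_sub_abs_le {X : ℕ → ℝ} {m n : ℕ} (hmn : m ≤ n)
    (hX : ∀ j, j < n → η / c j ≤ X (j + 1) - X j) {f : ℝ → ℝ} {K : ℝ} (hf : BddLip f K) :
    |walkMean c η n f - walkMean c η m f| ≤ K * (X n - X m) := by
  have hK : 0 ≤ K := (abs_nonneg _).trans (hf.bdd 0)
  induction n, hmn using Nat.le_induction with
  | base => simp
  | succ n hmn ih =>
    have h1 := ih fun j hj => hX j (by omega)
    have h2 := (walkMean_step hc hmono hη n hf).trans
      (mul_le_mul_of_nonneg_left (hX n (by omega)) hK)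
    rw [abs_le] at *
    constructor <;> linarith [h1.1, h1.2, h2.1, h2.2]

/-- The flux has derivative twice the mean of the derivative, up to a second-order error. -/
theorem walkFlux_sub_taylor {X : ℕ → ℝ} {m n : ℕ} (hmn : m ≤ n)
    (hX : ∀ j, j < n → η / c j ≤ X (j + 1) - X j) {f f' : ℝ → ℝ} {K : ℝ}
    (hf : TaylorBound f f' K) :
    |walkFlux c η n f - walkFlux c η m f - (n - m) * (2 * η * walkMean c η m f')|
      ≤ (n - m) * (2 * η * (K * (X n - X m))) := by
  have hK : 0 ≤ K := (abs_nonneg _).trans (hf.left.bdd 0)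
  refine abs_sub_sub_le_of_steps (u := fun n => walkFlux c η n f) hmn fun j hmj hjn => ?_
  have h1 := walkFlux_step_taylor hc hmono hη j hf
  have h2 := walkMean_sub_abs_le hc hmono hη hmj (fun i hi => hX i (by omega)) hf.right
  have h3 := hX j hjn
  have h4 := (sum_steps_le hc hη (X := X) (m := j + 1) (n := n) hjn hX).2
  calc |walkFlux c η (j + 1) f - walkFlux c η j f - 2 * η * walkMean c η m f'|
      = |(walkFlux c η (j + 1) f - walkFlux c η j f - 2 * η * walkMean c η j f')
          + 2 * η * (walkMean c η j f' - walkMean c η m f')| := by ring_nf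
    _ ≤ 2 * η * K * (η / c j) + 2 * η * (K * (X j - X m)) := by
        refine (abs_add_le _ _).trans (add_le_add h1 ?_)
        rw [abs_mul, abs_of_pos (by positivity : 0 < 2 * η)]
        gcongr
    _ = 2 * η * (K * (η / c j + (X j - X m))) := by ring
    _ ≤ 2 * η * (K * (X n - X m)) := by gcongr; linarith

/-- The mean has derivative half the flux of the derivative, times `1 / c ^ 2`, up to a
second-order error. -/
theorem walkMean_sub_taylor {m n : ℕ} (hmn : m ≤ n) {W W' : ℝ}
    (hW : ∀ j, m ≤ j → j < n → W' ≤ 1 / c j ^ 2 ∧ 1 / c j ^ 2 ≤ W) {f f' : ℝ → ℝ} {K : ℝ}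
    (hf : TaylorBound f f' K) :
    |walkMean c η n f - walkMean c η m f - (n - m) * (η / 2 * (W * walkFlux c η m f'))|
      ≤ (n - m) * (η * (K * (W * ((n - m) * η) + m * η * (W - W')))) := by
  have hK : 0 ≤ K := (abs_nonneg _).trans (hf.left.bdd 0)
  refine abs_sub_sub_le_of_steps (u := fun n => walkMean c η n f) hmn fun j hmj hjn => ?_
  have h1 := walkMean_step_taylor hc hmono hη j hf
  have h2 := walkFlux_sub_abs_le hc hmono hη hmj hf.right
  have h3 := walkFlux_abs_le hc hmono hη m hf.right
  obtain ⟨hW1, hW2⟩ := hW j hmj hjn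
  set q := 1 / c j ^ 2 with hq
  have hq0 : 0 ≤ q := by positivity
  have hW0 : 0 ≤ W := hq0.trans hW2
  have hjm : (0 : ℝ) ≤ j - m := sub_nonneg.mpr (by exact_mod_cast hmj)
  have hjn' : (j : ℝ) + 1 ≤ n := by exact_mod_cast hjn
  have e : K * (η / c j) ^ 2 = K * η ^ 2 * q := by rw [hq]; ring
  -- Two errors: the drift of the flux after step `m`, and the variation of the coefficient times
  -- the flux at `m`, which is at most `2mηK` because the flux starts at zero.
  have h4 : |q * walkFlux c η j f' - W * walkFlux c η m f'| ≤
      W * ((j - m) * (2 * η * K)) + (W - W') * (m * (2 * η * K)) := by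
    calc _ = |q * (walkFlux c η j f' - walkFlux c η m f') + (q - W) * walkFlux c η m f'| := by
          ring_nf
      _ ≤ q * |walkFlux c η j f' - walkFlux c η m f'| + (W - q) * |walkFlux c η m f'| := by
          refine (abs_add_le _ _).trans_eq ?_
          rw [abs_mul, abs_mul, abs_of_nonneg hq0, abs_of_nonpos (by linarith : q - W ≤ 0), neg_sub]
      _ ≤ _ := by
          refine add_le_add (mul_le_mul hW2 h2 (abs_nonneg _) hW0)
            (mul_le_mul (by linarith) h3 (abs_nonneg _) (by linarith))
  calc |walkMean c η (j + 1) f - walkMean c η j f - η / 2 * (W * walkFlux c η m f')|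
      = |(walkMean c η (j + 1) f - walkMean c η j f - η / 2 * (q * walkFlux c η j f'))
          + η / 2 * (q * walkFlux c η j f' - W * walkFlux c η m f')| := by ring_nf
    _ ≤ K * η ^ 2 * q + η / 2 * (W * ((j - m) * (2 * η * K)) + (W - W') * (m * (2 * η * K))) := by
        refine (abs_add_le _ _).trans (add_le_add (e ▸ h1) ?_)
        rw [abs_mul, abs_of_pos (by positivity : 0 < η / 2)]
        gcongr
    _ ≤ K * η ^ 2 * W + η / 2 * (W * ((j - m) * (2 * η * K)) + (W - W') * (m * (2 * η * K))) := by
        gcongr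
    _ = η * (K * (W * ((j + 1 - m) * η) + m * η * (W - W'))) := by ring
    _ ≤ η * (K * (W * ((n - m) * η) + m * η * (W - W'))) := by gcongr

end Walk

/-! ### The continuum limit of the walk -/

/-- The limit of a real sequence along a fixed nonprincipal ultrafilter. -/
noncomputable def ultralim (u : ℕ → ℝ) : ℝ := limUnder (hyperfilter ℕ : Filter ℕ) u

/-- A single ultrafilter serves all `ν` and all test functions at once, so linear relations and
inequalities pass to the limit without extracting subsequences. -/
theorem tendsto_ultralim {u : ℕ → ℝ} {C : ℝ} (h : ∀ N, |u N| ≤ C) :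
    Tendsto u (hyperfilter ℕ : Filter ℕ) (𝓝 (ultralim u)) := by
  obtain ⟨L, -, hL⟩ := (isCompact_Icc (a := -C) (b := C)).ultrafilter_le_nhds
    ((hyperfilter ℕ).map u)
    (le_principal_iff.mpr (Filter.mem_map.mpr (Eventually.of_forall fun n => abs_le.mp (h n))))
  exact tendsto_nhds_limUnder ⟨L, hL⟩

/-- The inverse square root of the coefficient at the grid points of mesh `1 / (N + 1)`. -/
noncomputable def gridCoeff (w : ℝ → ℝ) (N n : ℕ) : ℝ := 1 / √(w ((n + 1) * (1 / (N + 1))))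

/-- The index of the last grid point before `ν`. -/
noncomputable def gridIndex (N : ℕ) (ν : ℝ) : ℕ := ⌊ν * (N + 1)⌋₊

/-- The continuum limit of the mean of the walk. -/
noncomputable def limMean (w : ℝ → ℝ) (ν : ℝ) (f : ℝ → ℝ) : ℝ :=
  ultralim fun N => walkMean (gridCoeff w N) (1 / (N + 1)) (gridIndex N ν) f

/-- The continuum limit of the flux of the walk. -/
noncomputable def limFlux (w : ℝ → ℝ) (ν : ℝ) (f : ℝ → ℝ) : ℝ :=
  ultralim fun N => walkFlux (gridCoeff w N) (1 / (N + 1)) (gridIndex N ν) f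

theorem mesh_pos (N : ℕ) : (0 : ℝ) < 1 / (N + 1) := by positivity

theorem gridIndex_mul_le {N : ℕ} {ν : ℝ} (hν : 0 ≤ ν) : gridIndex N ν * (1 / (N + 1)) ≤ ν := by
  have h : (0 : ℝ) < N + 1 := by positivity
  rw [mul_one_div, div_le_iff₀ h]
  exact Nat.floor_le (by positivity)

theorem lt_gridIndex_mul (N : ℕ) (ν : ℝ) : ν < (gridIndex N ν + 1) * (1 / (N + 1)) := by
  have h : (0 : ℝ) < N + 1 := by positivity
  rw [mul_one_div, lt_div_iff₀ h]
  exact Nat.lt_floor_add_one _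

theorem gridIndex_mono (N : ℕ) {μ ν : ℝ} (h : μ ≤ ν) : gridIndex N μ ≤ gridIndex N ν :=
  Nat.floor_mono (by gcongr)

theorem tendsto_gridIndex_mul {ν : ℝ} (hν : 0 ≤ ν) :
    Tendsto (fun N : ℕ => gridIndex N ν * (1 / (N + 1) : ℝ)) (hyperfilter ℕ : Filter ℕ) (𝓝 ν) := by
  have h1 := (tendsto_nat_floor_mul_div_atTop hν).comp
    ((tendsto_natCast_atTop_atTop (R := ℝ)).comp (tendsto_add_atTop_nat 1))
  refine (h1.mono_left Nat.hyperfilter_le_atTop).congr fun N => ?_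
  simp [gridIndex, div_eq_mul_inv]

section Limit

variable {w : ℝ → ℝ}

theorem gridCoeff_pos (hpos : ∀ t, 0 < t → 0 < w t) (N n : ℕ) : 0 < gridCoeff w N n :=
  one_div_pos.mpr (Real.sqrt_pos.mpr (hpos _ (by positivity)))

theorem gridCoeff_mono (hpos : ∀ t, 0 < t → 0 < w t) (hanti : AntitoneOn w (Ioi 0)) (N : ℕ) :
    Monotone (gridCoeff w N) := fun m n hmn => by
  have h1 : (0 : ℝ) < (m + 1) * (1 / (N + 1)) := by positivity
  have h2 : (0 : ℝ) < (n + 1) * (1 / (N + 1)) := by positivity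
  refine one_div_le_one_div_of_le (Real.sqrt_pos.mpr (hpos _ h2)) (Real.sqrt_le_sqrt ?_)
  exact hanti h1 h2 (by gcongr)

theorem one_div_gridCoeff_sq (hpos : ∀ t, 0 < t → 0 < w t) (N n : ℕ) :
    1 / gridCoeff w N n ^ 2 = w ((n + 1) * (1 / (N + 1))) := by
  rw [gridCoeff, one_div_pow, one_div_one_div, Real.sq_sqrt (hpos _ (by positivity)).le]

theorem limMean_zero (f : ℝ → ℝ) : limMean w 0 f = f 0 := by
  have : (fun N => walkMean (gridCoeff w N) (1 / (N + 1)) (gridIndex N 0) f) = fun _ => f 0 := by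
    funext N; simp [gridIndex, walkMean_zero]
  rw [limMean, this]
  exact tendsto_nhds_unique (tendsto_ultralim fun _ => le_rfl) tendsto_const_nhds

/-- The coefficient is sampled at the right endpoint of each cell: this avoids the singularity at
`0` and is exactly where `hX` bounds the step. -/
theorem mesh_div_gridCoeff_le {T : ℝ} {X : ℝ → ℝ}
    (hX : ∀ a b, 0 ≤ a → a ≤ b → 0 < b → b ≤ T → (b - a) * √(w b) ≤ X b - X a)
    {N : ℕ} {ν : ℝ} (hν : 0 ≤ ν) (hνT : ν ≤ T) {j : ℕ} (hj : j < gridIndex N ν) :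
    1 / (N + 1) / gridCoeff w N j ≤ X ((j + 1 : ℕ) * (1 / (N + 1))) - X (j * (1 / (N + 1))) := by
  have hη := mesh_pos N
  have h := hX (j * (1 / (N + 1))) ((j + 1) * (1 / (N + 1))) (by positivity) (by gcongr; simp)
    (by positivity) (le_trans (le_trans (by gcongr; exact_mod_cast hj)
      (gridIndex_mul_le (N := N) hν)) hνT)
  rw [gridCoeff, div_div_eq_mul_div, div_one]
  push_cast
  refine le_trans (Eq.le ?_) h
  ring

theorem tendsto_speed {T : ℝ} {X : ℝ → ℝ} (hXc : ContinuousOn X (Icc 0 T)) {ν : ℝ}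
    (hν : ν ∈ Icc 0 T) :
    Tendsto (fun N : ℕ => X (gridIndex N ν * (1 / (N + 1)))) (hyperfilter ℕ : Filter ℕ)
      (𝓝 (X ν)) := by
  refine (hXc ν hν).tendsto.comp (tendsto_nhdsWithin_iff.mpr ⟨tendsto_gridIndex_mul hν.1,
    Eventually.of_forall fun N => ⟨by positivity, (gridIndex_mul_le hν.1).trans hν.2⟩⟩)

variable (hpos : ∀ t, 0 < t → 0 < w t) (hanti : AntitoneOn w (Ioi 0))

include hpos hanti

theorem tendsto_limMean (ν : ℝ) {f : ℝ → ℝ} {C : ℝ} (hf : ∀ x, |f x| ≤ C) :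
    Tendsto (fun N => walkMean (gridCoeff w N) (1 / (N + 1)) (gridIndex N ν) f)
      (hyperfilter ℕ : Filter ℕ) (𝓝 (limMean w ν f)) :=
  tendsto_ultralim fun N => walkMean_abs_le (gridCoeff_pos hpos N) (gridCoeff_mono hpos hanti N)
    (mesh_pos N) _ fun x _ => hf x

theorem limMean_add (ν : ℝ) {f g : ℝ → ℝ} {C C' : ℝ} (hf : ∀ x, |f x| ≤ C)
    (hg : ∀ x, |g x| ≤ C') : limMean w ν (f + g) = limMean w ν f + limMean w ν g := by
  refine tendsto_nhds_unique (tendsto_limMean hpos hanti ν (C := C + C') fun x =>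
    (abs_add_le _ _).trans (add_le_add (hf x) (hg x))) ?_
  simpa only [map_add] using (tendsto_limMean hpos hanti ν hf).add (tendsto_limMean hpos hanti ν hg)

theorem limMean_smul (ν a : ℝ) {f : ℝ → ℝ} {C : ℝ} (hf : ∀ x, |f x| ≤ C) :
    limMean w ν (a • f) = a * limMean w ν f := by
  refine tendsto_nhds_unique (tendsto_limMean hpos hanti ν (C := |a| * C) fun x => ?_) ?_
  · rw [Pi.smul_apply, smul_eq_mul, abs_mul]
    exact mul_le_mul_of_nonneg_left (hf x) (abs_nonneg a)
  · simpa only [map_smul, smul_eq_mul] using (tendsto_limMean hpos hanti ν hf).const_mul a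

theorem abs_walkFlux_le (N : ℕ) {ν : ℝ} (hν : 0 ≤ ν) {f : ℝ → ℝ} {K : ℝ} (hf : BddLip f K) :
    |walkFlux (gridCoeff w N) (1 / (N + 1)) (gridIndex N ν) f| ≤ 2 * ν * K := by
  have hK : 0 ≤ K := (abs_nonneg _).trans (hf.bdd 0)
  refine (walkFlux_abs_le (gridCoeff_pos hpos N) (gridCoeff_mono hpos hanti N)
    (mesh_pos N) _ hf).trans ?_
  calc (gridIndex N ν : ℝ) * (2 * (1 / (N + 1)) * K)
      = 2 * (gridIndex N ν * (1 / (N + 1))) * K := by ring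
    _ ≤ 2 * ν * K := by gcongr; exact gridIndex_mul_le hν

theorem tendsto_limFlux {ν : ℝ} (hν : 0 ≤ ν) {f : ℝ → ℝ} {K : ℝ} (hf : BddLip f K) :
    Tendsto (fun N => walkFlux (gridCoeff w N) (1 / (N + 1)) (gridIndex N ν) f)
      (hyperfilter ℕ : Filter ℕ) (𝓝 (limFlux w ν f)) :=
  tendsto_ultralim fun N => abs_walkFlux_le hpos hanti N hν hf

theorem abs_limFlux_le {ν : ℝ} (hν : 0 ≤ ν) {f : ℝ → ℝ} {K : ℝ} (hf : BddLip f K) :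
    |limFlux w ν f| ≤ 2 * ν * K :=
  le_of_tendsto' (tendsto_limFlux hpos hanti hν hf).abs
    fun N => abs_walkFlux_le hpos hanti N hν hf

variable {T : ℝ} {X : ℝ → ℝ}

theorem limMean_sub_taylor {μ ν : ℝ} (hμ : 0 < μ) (hμν : μ ≤ ν) {f f' : ℝ → ℝ} {K : ℝ}
    (hf : TaylorBound f f' K) :
    |limMean w ν f - limMean w μ f - (ν - μ) * (1 / 2 * (w μ * limFlux w μ f'))|
      ≤ (ν - μ) * (K * (w μ * (ν - μ) + μ * (w μ - w ν))) := by
  have hν := hμ.trans_le hμν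
  have tν := tendsto_gridIndex_mul hν.le
  have tμ := tendsto_gridIndex_mul hμ.le
  have l := (((tendsto_limMean hpos hanti ν hf.left.bdd).sub
    (tendsto_limMean hpos hanti μ hf.left.bdd)).sub ((tν.sub tμ).mul
      (((tendsto_limFlux hpos hanti hμ.le hf.right).const_mul (w μ)).const_mul (1 / 2)))).abs
  have r := (tν.sub tμ).mul ((((tν.sub tμ).const_mul (w μ)).add
    (tμ.mul_const (w μ - w ν))).const_mul K)
  refine le_of_tendsto_of_tendsto' l r fun N => ?_
  have hη := mesh_pos N
  have key := walkMean_sub_taylor (gridCoeff_pos hpos N) (gridCoeff_mono hpos hanti N) hη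
    (gridIndex_mono N hμν) (W := w μ) (W' := w ν) (fun j hj hjn => ?_) hf
  · refine (Eq.le ?_).trans (key.trans (Eq.le ?_))
    · congr 1; ring
    · ring
  · rw [one_div_gridCoeff_sq hpos]
    -- For these `j` the sampling point `(j + 1) / (N + 1)` lies in `(μ, ν]`, so the coefficient
    -- there is between `w ν` and `w μ`.
    have hj0 : (0 : ℝ) < (j + 1) * (1 / (N + 1)) := by positivity
    constructor
    · refine hanti hj0 hν (le_trans ?_ (gridIndex_mul_le (N := N) hν.le))
      gcongr
      exact_mod_cast hjn
    · refine hanti hμ hj0 ((lt_gridIndex_mul N μ).le.trans ?_)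
      gcongr

variable (hX : ∀ a b, 0 ≤ a → a ≤ b → 0 < b → b ≤ T → (b - a) * √(w b) ≤ X b - X a)

include hX

/-- Finite speed of propagation. -/
theorem abs_limMean_le (hX0 : X 0 = 0) (hXm : MonotoneOn X (Icc 0 T)) {ν : ℝ} (hν : ν ∈ Icc 0 T)
    {f : ℝ → ℝ} {C : ℝ} (hf : ∀ x, |x| ≤ X ν → |f x| ≤ C) : |limMean w ν f| ≤ C := by
  have hb : ∀ N, |walkMean (gridCoeff w N) (1 / (N + 1)) (gridIndex N ν) f| ≤ C := by
    intro N
    have hle := gridIndex_mul_le (N := N) hν.1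
    have h0 : (0 : ℝ) ≤ gridIndex N ν * (1 / (N + 1)) := by positivity
    refine walkMean_abs_le (gridCoeff_pos hpos N) (gridCoeff_mono hpos hanti N) (mesh_pos N) _
      fun x hx => hf x (hx.trans ?_)
    refine ((sum_steps_le (gridCoeff_pos hpos N) (mesh_pos N)
      (X := fun j => X (j * (1 / (N + 1)))) le_rfl
      fun j hj => mesh_div_gridCoeff_le hX hν.1 hν.2 hj).1).trans ?_
    simp only [Nat.cast_zero, zero_mul, hX0, sub_zero]
    exact hXm ⟨h0, hle.trans hν.2⟩ hν hle
  exact le_of_tendsto' (tendsto_ultralim hb).abs hb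

theorem limMean_sub_abs_le (hXc : ContinuousOn X (Icc 0 T)) {μ ν : ℝ} (hμ : 0 ≤ μ) (hμν : μ ≤ ν)
    (hν : ν ≤ T) {f : ℝ → ℝ} {K : ℝ} (hf : BddLip f K) :
    |limMean w ν f - limMean w μ f| ≤ K * (X ν - X μ) := by
  have hν0 := hμ.trans hμν
  refine le_of_tendsto_of_tendsto' ((tendsto_limMean hpos hanti ν hf.bdd).sub
    (tendsto_limMean hpos hanti μ hf.bdd)).abs
    (((tendsto_speed hXc ⟨hν0, hν⟩).sub (tendsto_speed hXc ⟨hμ, hμν.trans hν⟩)).const_mul K)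
    fun N => ?_
  exact walkMean_sub_abs_le (gridCoeff_pos hpos N) (gridCoeff_mono hpos hanti N) (mesh_pos N)
    (X := fun j => X (j * (1 / (N + 1)))) (gridIndex_mono N hμν)
    (fun j hj => mesh_div_gridCoeff_le hX hν0 hν hj) hf

theorem limFlux_sub_taylor (hXc : ContinuousOn X (Icc 0 T)) {μ ν : ℝ} (hμ : 0 ≤ μ) (hμν : μ ≤ ν)
    (hν : ν ≤ T) {f f' : ℝ → ℝ} {K : ℝ} (hf : TaylorBound f f' K) :
    |limFlux w ν f - limFlux w μ f - (ν - μ) * (2 * limMean w μ f')|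
      ≤ (ν - μ) * (2 * (K * (X ν - X μ))) := by
  have hν0 := hμ.trans hμν
  have tν := tendsto_gridIndex_mul hν0
  have tμ := tendsto_gridIndex_mul hμ
  have l := (((tendsto_limFlux hpos hanti hν0 hf.left).sub
    (tendsto_limFlux hpos hanti hμ hf.left)).sub ((tν.sub tμ).mul
      ((tendsto_limMean hpos hanti μ hf.right.bdd).const_mul 2))).abs
  have r := (tν.sub tμ).mul ((((tendsto_speed hXc ⟨hν0, hν⟩).sub
    (tendsto_speed hXc ⟨hμ, hμν.trans hν⟩)).const_mul K).const_mul 2)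
  refine le_of_tendsto_of_tendsto' l r fun N => ?_
  have key := walkFlux_sub_taylor (gridCoeff_pos hpos N) (gridCoeff_mono hpos hanti N) (mesh_pos N)
    (X := fun j => X (j * (1 / (N + 1)))) (gridIndex_mono N hμν)
    (fun j hj => mesh_div_gridCoeff_le hX hν0 hν hj) hf
  refine (Eq.le ?_).trans (key.trans (Eq.le ?_))
  · congr 1; ring
  · ring

end Limit

/-! ### Existence of a regular kernel -/

/-- The walk yields only expansions about the left endpoint. For increments to the left of `x` the
slope is `g y`, and continuity of `g` replaces it by `g x`. -/
theorem hasDerivWithinAt_of_forward_taylor {S : Set ℝ} {F g : ℝ → ℝ} {e : ℝ → ℝ → ℝ} {x : ℝ}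
    (hx : x ∈ S) (h : ∀ a ∈ S, ∀ b ∈ S, a ≤ b → |F b - F a - (b - a) * g a| ≤ (b - a) * e a b)
    (hg : ContinuousWithinAt g S x) (hr : Tendsto (fun y => e x y) (𝓝[S] x) (𝓝 0))
    (hl : Tendsto (fun y => e y x) (𝓝[S] x) (𝓝 0)) : HasDerivWithinAt F (g x) S x := by
  refine hasDerivWithinAt_of_modulus (m := fun y => |g y - g x| + |e x y| + |e y x|) ?_ ?_
  · have hg' : Tendsto (fun y => g y - g x) (𝓝[S] x) (𝓝 0) := by
      simpa using hg.tendsto.sub_const (g x)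
    simpa using (hg'.abs.add hr.abs).add hl.abs
  filter_upwards [self_mem_nhdsWithin] with y hy
  have hn1 := abs_nonneg (g y - g x)
  have hn2 := abs_nonneg (e x y)
  have hn3 := abs_nonneg (e y x)
  rcases le_total x y with hxy | hyx
  · rw [abs_of_nonneg (sub_nonneg.mpr hxy), mul_comm _ (y - x)]
    refine (h x hx y hy hxy).trans (mul_le_mul_of_nonneg_left ?_ (sub_nonneg.mpr hxy))
    linarith [le_abs_self (e x y)]
  · rw [abs_sub_comm y x, abs_of_nonneg (sub_nonneg.mpr hyx), mul_comm _ (x - y)]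
    calc |F y - F x - (y - x) * g x|
        = |-(F x - F y - (x - y) * g y) + (x - y) * -(g y - g x)| := by ring_nf
      _ ≤ (x - y) * e y x + (x - y) * |g y - g x| := by
          refine (abs_add_le _ _).trans (add_le_add ?_ (Eq.le ?_))
          · rw [abs_neg]; exact h y hy x hx hyx
          · rw [abs_mul, abs_neg, abs_of_nonneg (sub_nonneg.mpr hyx)]
      _ = (x - y) * (e y x + |g y - g x|) := by ring
      _ ≤ _ := by
          refine mul_le_mul_of_nonneg_left ?_ (sub_nonneg.mpr hyx)
          linarith [le_abs_self (e y x)]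

/-- The derivative of a test function. -/
noncomputable abbrev testDeriv (ψ : 𝓓((⊤ : TopologicalSpace.Opens ℝ), ℝ)) :
    𝓓((⊤ : TopologicalSpace.Opens ℝ), ℝ) := ∂_{(1 : ℝ)} ψ

theorem testFunction_exists_bound (ψ : 𝓓((⊤ : TopologicalSpace.Opens ℝ), ℝ)) :
    ∃ C : ℝ, ∀ x, |ψ x| ≤ C :=
  ψ.continuous.bounded_above_of_compact_support ψ.hasCompactSupport

theorem testFunction_hasDerivAt (ψ : 𝓓((⊤ : TopologicalSpace.Opens ℝ), ℝ)) (x : ℝ) :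
    HasDerivAt ψ (testDeriv ψ x) x := by
  have h1 : testDeriv ψ x = deriv ψ x := by
    change (TestFunction.lineDerivCLM ℝ (1 : ℝ) ψ : 𝓓((⊤ : TopologicalSpace.Opens ℝ), ℝ)) x = _
    rw [TestFunction.lineDerivCLM_apply_of_le (𝕜 := ℝ) (by simp)]
    simp [lineDeriv, deriv_comp_const_add]
  rw [h1]
  exact (ψ.contDiff.differentiable (by simp) x).hasDerivAt

theorem testFunction_taylorBound (ψ : 𝓓((⊤ : TopologicalSpace.Opens ℝ), ℝ)) :
    ∃ K : ℝ, 0 ≤ K ∧ TaylorBound ψ (testDeriv ψ) K := by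
  obtain ⟨C₀, h₀⟩ := testFunction_exists_bound ψ
  obtain ⟨C₁, h₁⟩ := testFunction_exists_bound (testDeriv ψ)
  obtain ⟨C₂, h₂⟩ := testFunction_exists_bound (testDeriv (testDeriv ψ))
  set K := max C₀ (max C₁ C₂)
  have k₀ : ∀ x, |ψ x| ≤ K := fun x => (h₀ x).trans (le_max_left _ _)
  have k₁ : ∀ x, |testDeriv ψ x| ≤ K := fun x =>
    (h₁ x).trans ((le_max_left _ _).trans (le_max_right _ _))
  have k₂ : ∀ x, |(testDeriv (testDeriv ψ)) x| ≤ K := fun x =>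
    (h₂ x).trans ((le_max_right _ _).trans (le_max_right _ _))
  refine ⟨K, (abs_nonneg _).trans (k₀ 0), ⟨k₀, fun x h => ?_⟩, ⟨k₁, fun x h => ?_⟩, fun x h => ?_⟩
  · simpa using abs_sub_le_of_hasDerivAt convex_univ (testFunction_hasDerivAt ψ)
      (fun x _ => k₁ x) (mem_univ x) (mem_univ (x + h))
  · simpa using abs_sub_le_of_hasDerivAt convex_univ (testFunction_hasDerivAt (testDeriv ψ))
      (fun x _ => k₂ x) (mem_univ x) (mem_univ (x + h))
  · simpa using abs_taylor_le_of_hasDerivAt convex_univ (testFunction_hasDerivAt ψ)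
      (testFunction_hasDerivAt (testDeriv ψ)) (fun x _ => k₂ x) (mem_univ x) (mem_univ (x + h))

/-- The distribution of order zero given by a linear form that is bounded in the uniform norm. -/
noncomputable def distributionOfBound (L : 𝓓((⊤ : TopologicalSpace.Opens ℝ), ℝ) →ₗ[ℝ] ℝ) (C : ℝ)
    (hL : ∀ ψ (B : ℝ), (∀ x, |ψ x| ≤ B) → |L ψ| ≤ C * B) :
    𝓓'((⊤ : TopologicalSpace.Opens ℝ), ℝ) where
  toFun := L
  map_add' := L.map_add
  map_smul' := L.map_smul
  cont := by
    refine continuous_of_continuousAt_zero L ?_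
    have h := ((TestFunction.toBoundedContinuousFunctionCLM ℝ :
      𝓓((⊤ : TopologicalSpace.Opens ℝ), ℝ) →L[ℝ] _).continuous.norm.const_mul C).tendsto 0
    rw [map_zero, norm_zero, mul_zero] at h
    rw [ContinuousAt, map_zero]
    refine squeeze_zero_norm (fun ψ => ?_) h
    exact hL ψ _ fun x => (TestFunction.toBoundedContinuousFunctionCLM ℝ ψ).norm_coe_le_norm x

section Existence

/-- The coefficient of the equation, continued by a constant beyond `νs`. -/
noncomputable def truncCoeff (νs t : ℝ) : ℝ := waveCoeff (min t νs)

variable {νs : ℝ}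

theorem truncCoeff_of_le {t : ℝ} (h : t ≤ νs) : truncCoeff νs t = waveCoeff t := by
  rw [truncCoeff, min_eq_left h]

theorem charSpeed_mono (hνs' : νs < nuCr) : MonotoneOn charSpeed (Icc 0 νs) := by
  intro a ha b hb hab
  rcases ha.1.eq_or_lt with h | h
  · rcases hb.1.eq_or_lt with h' | h'
    · rw [← h, ← h']
    · have := mul_sqrt_waveCoeff_le ha.1 (hb.2.trans hνs'.le) hab h'
      have := mul_nonneg (sub_nonneg.mpr hab) (Real.sqrt_nonneg (waveCoeff b))
      linarith
  · have := mul_sqrt_waveCoeff_le ha.1 (hb.2.trans hνs'.le) hab (h.trans_le hab)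
    have := mul_nonneg (sub_nonneg.mpr hab) (Real.sqrt_nonneg (waveCoeff b))
    linarith

theorem mul_sqrt_truncCoeff_le (hνs' : νs < nuCr) (a b : ℝ) (ha : 0 ≤ a) (hab : a ≤ b)
    (hb : 0 < b) (hbs : b ≤ νs) :
    (b - a) * √(truncCoeff νs b) ≤ charSpeed b - charSpeed a := by
  rw [truncCoeff_of_le hbs]
  exact mul_sqrt_waveCoeff_le ha (hbs.trans hνs'.le) hab hb

theorem clamp_mem (hνs : 0 < νs) (t : ℝ) : max 0 (min t νs) ∈ Icc 0 νs :=
  ⟨le_max_left _ _, max_le hνs.le (min_le_right _ _)⟩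

theorem clamp_of_mem {t : ℝ} (ht : t ∈ Icc 0 νs) : max 0 (min t νs) = t := by
  rw [min_eq_left ht.2, max_eq_right ht.1]

variable (hνs : 0 < νs) (hνs' : νs < nuCr)

include hνs hνs'

/-- The strict inequality `νs < nuCr` matters: the coefficient vanishes at the sonic value. -/
theorem truncCoeff_pos (t : ℝ) (ht : 0 < t) : 0 < truncCoeff νs t :=
  waveCoeff_pos ⟨lt_min ht hνs, (min_le_right _ _).trans_lt hνs'⟩

theorem antitoneOn_truncCoeff : AntitoneOn (truncCoeff νs) (Ioi 0) := fun _ ha _ hb hab =>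
  antitoneOn_waveCoeff ⟨lt_min ha hνs, (min_le_right _ _).trans hνs'.le⟩
    ⟨lt_min hb hνs, (min_le_right _ _).trans hνs'.le⟩ (min_le_min_right _ hab)

theorem continuousOn_limMean (ψ : 𝓓((⊤ : TopologicalSpace.Opens ℝ), ℝ)) :
    ContinuousOn (fun ν => limMean (truncCoeff νs) ν ψ) (Icc 0 νs) := by
  obtain ⟨K, hK, hψ⟩ := testFunction_taylorBound ψ
  have hXc : ContinuousOn charSpeed (Icc 0 νs) :=
    continuousOn_charSpeed.mono (Icc_subset_Icc_right hνs'.le)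
  have key : ∀ a ∈ Icc 0 νs, ∀ b ∈ Icc 0 νs,
      |limMean (truncCoeff νs) b ψ - limMean (truncCoeff νs) a ψ| ≤
        K * |charSpeed b - charSpeed a| := by
    intro a ha b hb
    rcases le_total a b with h | h
    · exact (limMean_sub_abs_le (truncCoeff_pos hνs hνs') (antitoneOn_truncCoeff hνs hνs')
        (mul_sqrt_truncCoeff_le hνs') hXc ha.1 h hb.2 hψ.left).trans
        (mul_le_mul_of_nonneg_left (le_abs_self _) hK)
    · rw [abs_sub_comm, abs_sub_comm (charSpeed b)]
      exact (limMean_sub_abs_le (truncCoeff_pos hνs hνs') (antitoneOn_truncCoeff hνs hνs')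
        (mul_sqrt_truncCoeff_le hνs') hXc hb.1 h ha.2 hψ.left).trans
        (mul_le_mul_of_nonneg_left (le_abs_self _) hK)
  intro x hx
  rw [ContinuousWithinAt, tendsto_iff_norm_sub_tendsto_zero]
  have h0 : Tendsto (fun y => K * |charSpeed y - charSpeed x|) (𝓝[Icc 0 νs] x) (𝓝 0) := by
    simpa using (((hXc x hx).tendsto.sub_const (charSpeed x)).abs.const_mul K)
  refine squeeze_zero' (Eventually.of_forall fun _ => norm_nonneg _) ?_ h0
  filter_upwards [self_mem_nhdsWithin] with y hy
  exact key x hx y hy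

theorem hasDerivWithinAt_limFlux (ψ : 𝓓((⊤ : TopologicalSpace.Opens ℝ), ℝ)) {ν : ℝ}
    (hν : ν ∈ Icc 0 νs) :
    HasDerivWithinAt (fun t => limFlux (truncCoeff νs) t ψ)
      (2 * limMean (truncCoeff νs) ν (testDeriv ψ)) (Icc 0 νs) ν := by
  obtain ⟨K, hK, hψ⟩ := testFunction_taylorBound ψ
  have hXc : ContinuousOn charSpeed (Icc 0 νs) :=
    continuousOn_charSpeed.mono (Icc_subset_Icc_right hνs'.le)
  have hX := (hXc ν hν).tendsto
  refine hasDerivWithinAt_of_forward_taylor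
    (g := fun t => 2 * limMean (truncCoeff νs) t (testDeriv ψ))
    (e := fun a b => 2 * (K * (charSpeed b - charSpeed a))) hν ?_ ?_ ?_ ?_
  · intro a ha b hb hab
    exact limFlux_sub_taylor (truncCoeff_pos hνs hνs') (antitoneOn_truncCoeff hνs hνs')
      (mul_sqrt_truncCoeff_le hνs') hXc ha.1 hab hb.2 hψ
  · exact (continuousOn_limMean hνs hνs' (testDeriv ψ) ν hν).const_mul 2
  · simpa using ((hX.sub_const (charSpeed ν)).const_mul K).const_mul 2
  · simpa using ((hX.const_sub (charSpeed ν)).const_mul K).const_mul 2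

/-- The point `0` is excluded because the remainder involves the value and the oscillation of the
coefficient, which is continuous only on `(0, νs]`. -/
theorem hasDerivWithinAt_limMean (ψ : 𝓓((⊤ : TopologicalSpace.Opens ℝ), ℝ)) {ν : ℝ}
    (hν : ν ∈ Ioc 0 νs) :
    HasDerivWithinAt (fun t => limMean (truncCoeff νs) t ψ)
      (1 / 2 * (truncCoeff νs ν * limFlux (truncCoeff νs) ν (testDeriv ψ))) (Ioc 0 νs) ν := by
  obtain ⟨K, hK, hψ⟩ := testFunction_taylorBound ψ
  have hw : ContinuousOn (truncCoeff νs) (Ioc 0 νs) :=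
    (continuousOn_waveCoeff.mono (Ioc_subset_Ioc_right hνs'.le)).congr
      fun t ht => truncCoeff_of_le ht.2
  have hG : ContinuousWithinAt (fun t => limFlux (truncCoeff νs) t (testDeriv ψ)) (Ioc 0 νs) ν :=
    (hasDerivWithinAt_limFlux hνs hνs' (testDeriv ψ)
      ⟨hν.1.le, hν.2⟩).continuousWithinAt.mono Ioc_subset_Icc_self
  have hest := fun a (ha : a ∈ Ioc 0 νs) b (_ : b ∈ Ioc 0 νs) (hab : a ≤ b) =>
    limMean_sub_taylor (truncCoeff_pos hνs hνs') (antitoneOn_truncCoeff hνs hνs') ha.1 hab hψ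
  generalize truncCoeff νs = w at *
  have hwν : Tendsto w (𝓝[Ioc 0 νs] ν) (𝓝 (w ν)) := hw ν hν
  have hid : Tendsto (fun y : ℝ => y) (𝓝[Ioc 0 νs] ν) (𝓝 ν) := nhdsWithin_le_nhds
  refine hasDerivWithinAt_of_forward_taylor
    (g := fun t => 1 / 2 * (w t * limFlux w t (testDeriv ψ)))
    (e := fun a b => K * (w a * (b - a) + a * (w a - w b))) hν hest ?_ ?_ ?_
  · exact ((hw ν hν).mul hG).const_mul _
  · have h1 := (hid.sub_const ν).const_mul (w ν)
    have h2 := (hwν.const_sub (w ν)).const_mul ν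
    have h3 := (h1.add h2).const_mul K
    rwa [sub_self, sub_self, mul_zero, mul_zero, add_zero, mul_zero] at h3
  · have h1 := hwν.mul (hid.const_sub ν)
    have h2 := hid.mul (hwν.sub_const (w ν))
    have h3 := (h1.add h2).const_mul K
    rwa [sub_self, sub_self, mul_zero, mul_zero, add_zero, mul_zero] at h3

theorem continuous_clamp_limMean (ψ : 𝓓((⊤ : TopologicalSpace.Opens ℝ), ℝ)) :
    Continuous fun t => limMean (truncCoeff νs) (max 0 (min t νs)) ψ :=
  (continuousOn_limMean hνs hνs' ψ).comp_continuous (by fun_prop) (clamp_mem hνs)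

/-- The `ν`-derivative of the kernel: the law of the limiting walk at time `ν`. -/
noncomputable def kernelDeriv (ν : ℝ) : 𝓓'((⊤ : TopologicalSpace.Opens ℝ), ℝ) :=
  distributionOfBound
    { toFun := fun ψ => limMean (truncCoeff νs) (max 0 (min ν νs)) ψ
      map_add' := fun ψ χ => limMean_add (truncCoeff_pos hνs hνs') (antitoneOn_truncCoeff hνs hνs')
        _ (testFunction_exists_bound ψ).choose_spec (testFunction_exists_bound χ).choose_spec
      map_smul' := fun a ψ => limMean_smul (truncCoeff_pos hνs hνs')
        (antitoneOn_truncCoeff hνs hνs') _ a (testFunction_exists_bound ψ).choose_spec } 1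
    fun ψ B h => by
      rw [one_mul]
      exact abs_limMean_le (truncCoeff_pos hνs hνs') (antitoneOn_truncCoeff hνs hνs')
        (mul_sqrt_truncCoeff_le hνs') charSpeed_zero (charSpeed_mono hνs') (clamp_mem hνs ν)
        fun x _ => h x

theorem kernelDeriv_apply (ν : ℝ) (ψ : 𝓓((⊤ : TopologicalSpace.Opens ℝ), ℝ)) :
    kernelDeriv hνs hνs' ν ψ = limMean (truncCoeff νs) (max 0 (min ν νs)) ψ := rfl

theorem continuous_kernelDeriv (ψ : 𝓓((⊤ : TopologicalSpace.Opens ℝ), ℝ)) :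
    Continuous fun t => kernelDeriv hνs hνs' t ψ := continuous_clamp_limMean hνs hνs' ψ

theorem abs_kernelDeriv_le {ν B : ℝ} {ψ : 𝓓((⊤ : TopologicalSpace.Opens ℝ), ℝ)} (hν : ν ∈ Icc 0 νs)
    (h : ∀ x, |x| ≤ charSpeed ν → |ψ x| ≤ B) : |kernelDeriv hνs hνs' ν ψ| ≤ B := by
  rw [kernelDeriv_apply, clamp_of_mem hν]
  exact abs_limMean_le (truncCoeff_pos hνs hνs') (antitoneOn_truncCoeff hνs hνs')
    (mul_sqrt_truncCoeff_le hνs') charSpeed_zero (charSpeed_mono hνs') hν h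

/-- The kernel, the primitive in `ν` of its derivative. -/
noncomputable def kernel (ν : ℝ) : 𝓓'((⊤ : TopologicalSpace.Opens ℝ), ℝ) :=
  distributionOfBound
    { toFun := fun ψ => ∫ t in (0 : ℝ)..ν, kernelDeriv hνs hνs' t ψ
      map_add' := fun ψ χ => by
        simp only [map_add]
        exact intervalIntegral.integral_add
          ((continuous_kernelDeriv hνs hνs' ψ).intervalIntegrable _ _)
          ((continuous_kernelDeriv hνs hνs' χ).intervalIntegrable _ _)
      map_smul' := fun a ψ => by
        simp only [map_smul, RingHom.id_apply]
        exact intervalIntegral.integral_smul _ _ } |ν|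
    fun ψ B h => by
      rw [mul_comm]
      have := intervalIntegral.norm_integral_le_of_norm_le_const (a := 0) (b := ν) (C := B)
        (f := fun t => kernelDeriv hνs hνs' t ψ) fun t _ => by
          -- Clamping is idempotent, so any time `t` reduces to one in `[0, νs]`.
          rw [kernelDeriv_apply, ← clamp_of_mem (clamp_mem hνs t), ← kernelDeriv_apply hνs hνs']
          exact abs_kernelDeriv_le hνs hνs' (clamp_mem hνs t) fun x _ => h x
      simpa using this

theorem kernel_apply (ν : ℝ) (ψ : 𝓓((⊤ : TopologicalSpace.Opens ℝ), ℝ)) :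
    kernel hνs hνs' ν ψ = ∫ t in (0 : ℝ)..ν, kernelDeriv hνs hνs' t ψ := rfl

theorem hasDerivAt_kernel (ψ : 𝓓((⊤ : TopologicalSpace.Opens ℝ), ℝ)) (ν : ℝ) :
    HasDerivAt (fun t => kernel hνs hνs' t ψ) (kernelDeriv hνs hνs' ν ψ) ν :=
  (continuous_kernelDeriv hνs hνs' ψ).integral_hasStrictDerivAt 0 ν |>.hasDerivAt

/-- Both sides vanish at `0` and have the same `ν`-derivative. Eliminating the flux this way closes
the first-order system into the second-order equation. -/
theorem limFlux_eq (ψ : 𝓓((⊤ : TopologicalSpace.Opens ℝ), ℝ)) {ν : ℝ} (hν : ν ∈ Icc 0 νs) :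
    limFlux (truncCoeff νs) ν ψ = 2 * kernel hνs hνs' ν (testDeriv ψ) := by
  obtain ⟨K, hK, hψ⟩ := testFunction_taylorBound ψ
  have h0 : limFlux (truncCoeff νs) 0 ψ = 0 := by
    have := abs_limFlux_le (truncCoeff_pos hνs hνs') (antitoneOn_truncCoeff hνs hνs') le_rfl hψ.left
    simpa using this
  have h := (convex_Icc 0 νs).norm_image_sub_le_of_norm_hasDerivWithin_le (C := 0)
    (f := fun t => limFlux (truncCoeff νs) t ψ - 2 * kernel hνs hνs' t (testDeriv ψ))
    (f' := fun _ => 0) (fun t ht => by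
      have h1 := hasDerivWithinAt_limFlux hνs hνs' ψ ht
      have h2 := ((hasDerivAt_kernel hνs hνs' (testDeriv ψ) t).const_mul 2).hasDerivWithinAt
        (s := Icc 0 νs)
      rw [kernelDeriv_apply, clamp_of_mem ht] at h2
      exact (h1.sub h2).congr_deriv (sub_self _)) (fun _ _ => by simp) ⟨le_rfl, hνs.le⟩ hν
  simp only [h0, kernel_apply, intervalIntegral.integral_same, zero_mul, norm_le_zero_iff, mul_zero,
    sub_zero, sub_eq_zero] at h
  rw [h, kernel_apply]

theorem isRegularKernel_kernel :
    IsRegularKernel νs (kernel hνs hνs') (kernelDeriv hνs hνs') where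
  hasDeriv ψ ν _ := (hasDerivAt_kernel hνs hνs' ψ ν).hasDerivWithinAt
  continuous_deriv ψ := (continuous_kernelDeriv hνs hνs' ψ).continuousOn
  wave ψ ν hν := by
    have hν' : ν ∈ Icc 0 νs := ⟨hν.1.le, hν.2⟩
    -- Away from `0` the two intervals have the same germ at `ν`, so the derivative within the
    -- half-open one suffices.
    have hmem : Ioc 0 νs ∈ 𝓝[Icc 0 νs] ν := by
      filter_upwards [self_mem_nhdsWithin, mem_nhdsWithin_of_mem_nhds (Ioi_mem_nhds hν.1)]
        with y hy hy' using ⟨hy', hy.2⟩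
    have h := (hasDerivWithinAt_limMean hνs hνs' ψ hν).mono_of_mem_nhdsWithin hmem
    rw [limFlux_eq hνs hνs' _ hν', truncCoeff_of_le hν.2] at h
    rw [Distribution.lineDerivOp_apply_apply, Distribution.lineDerivOp_apply_apply, map_neg,
      LineDeriv.lineDerivOp_neg, map_neg, neg_neg]
    refine (h.congr (fun t ht => ?_) ?_).congr_deriv (by ring)
    · rw [kernelDeriv_apply, clamp_of_mem ht]
    · rw [kernelDeriv_apply, clamp_of_mem hν']
  init := by
    ext ψ
    rw [kernel_apply, intervalIntegral.integral_same]; rfl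
  init_deriv := by
    ext ψ
    rw [kernelDeriv_apply, clamp_of_mem ⟨le_rfl, hνs.le⟩, limMean_zero, Distribution.delta_apply]
  support_subset ν hν ψ hψ := by
    rw [kernel_apply]
    refine intervalIntegral.integral_zero_ae (Eventually.of_forall fun t ht => ?_)
    rw [uIoc_of_le hν.1] at ht
    have ht' : t ∈ Icc 0 νs := ⟨ht.1.le, ht.2.trans hν.2⟩
    -- Finite speed with bound `0`: at each earlier time `t`, `ψ` vanishes on the smaller cone
    -- section `|x| ≤ k(t)`.
    refine abs_nonpos_iff.mp (abs_kernelDeriv_le hνs hνs' ht' fun x hx => ?_)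
    have hx' : x ∉ tsupport ψ := fun hmem =>
      absurd (hψ hmem) (not_lt.mpr (hx.trans (charSpeed_mono hνs' ht' hν ht.2)))
    rw [image_eq_zero_of_notMem_tsupport hx', abs_zero]

end Existence

end Morawetz

theorem mainTheorem6 (νs : ℝ) (hνs : 0 < νs) (hνs' : νs < Morawetz.nuCr) :
    (∃ H Hν : ℝ → 𝓓'((⊤ : TopologicalSpace.Opens ℝ), ℝ), Morawetz.IsRegularKernel νs H Hν) ∧
    ∀ H Hν : ℝ → 𝓓'((⊤ : TopologicalSpace.Opens ℝ), ℝ), Morawetz.IsRegularKernel νs H Hν →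
      ∀ (φ : ℝ → ℝ) (hφ : ContDiff ℝ ∞ φ),
        (∀ ν ∈ Icc 0 νs,
          ContDiff ℝ ∞
            (Morawetz.smoothConv (Morawetz.charSpeed νs) (Morawetz.cancelDist H Hν ν) φ hφ) ∧
          ContDiff ℝ ∞ (Morawetz.smoothConv (Morawetz.charSpeed νs) (Hν ν) φ hφ) ∧
          ContDiff ℝ ∞ (Morawetz.smoothConv (Morawetz.charSpeed νs) (∂_{(1 : ℝ)} (H ν)) φ hφ)) ∧
        (∀ R : ℝ, ∃ C > 0, ∀ ν ∈ Icc 0 νs, ∀ s ∈ Icc (-R) R,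
          Morawetz.EstimatesAt νs H Hν φ hφ C ν s) ∧
        ((∀ i : ℕ, ∃ B : ℝ, ∀ t : ℝ, |iteratedDeriv i φ t| ≤ B) →
          ∃ C > 0, ∀ ν ∈ Icc 0 νs, ∀ s : ℝ, Morawetz.EstimatesAt νs H Hν φ hφ C ν s) := by
  refine ⟨⟨_, _, Morawetz.isRegularKernel_kernel hνs hνs'⟩, fun H Hν h φ hφ => ⟨fun ν _ =>
    ⟨Morawetz.contDiff_smoothConv _ _ _ _, Morawetz.contDiff_smoothConv _ _ _ _,
      Morawetz.contDiff_smoothConv _ _ _ _⟩, fun R => ?_, fun hB => ?_⟩⟩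
  · refine h.exists_estimates hνs'.le hφ (Icc (-R) R) fun i => ?_
    set r := |Morawetz.charSpeed νs| + 2
    -- For `|s| ≤ R` only the values of `φ` within distance `r` of `s` enter.
    obtain ⟨B, hB⟩ := (isCompact_Icc (a := -(R + r)) (b := R + r)).exists_bound_of_continuousOn
      (Morawetz.contDiff_iteratedDeriv hφ i).continuous.continuousOn
    refine ⟨B, fun s hs t ht => hB _ ?_⟩
    have ht' := abs_le.mp ht
    constructor <;> linarith [hs.1, hs.2, ht'.1, ht'.2]
  · obtain ⟨C, hC, hest⟩ := h.exists_estimates hνs'.le hφ univ fun i => by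
      obtain ⟨B, hB⟩ := hB i
      exact ⟨B, fun s _ t _ => hB _⟩
    exact ⟨C, hC, fun ν hν s => hest ν hν s (mem_univ s)⟩
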